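/- **Setting.** For $k\in\mathbb Z$ let $\mathcal M_k$ be the space of holomorphic functions on the upper half-plane $\mathbb H$ that are modular forms of weight $k$ (holomorphic at the cusps) for some principal congruence subgroup $\Gamma(N)$, $N\ge 1$, and let $\mathcal M=\bigoplus_{k\in\mathbb Z}\mathcal M_k$ be the graded algebra of modular forms of all levels, with the pointwise product. The group $\mathrm{GL}^+(2,\mathbb Q)$ acts on the right on $\mathcal M$ by $$(f|\gamma)(z)=\det(\gamma)^{k/2}(cz+d)^{-k}f(\gamma z),\qquad f\in\mathcal M_k,\ \gamma=\begin{pmatrix}a&b\\c&d\end{pmatrix}.$$ Let $\mathcal A=\mathcal M\rtimes\mathrm{GL}^+(2,\mathbb Q)$ be the crossed product algebra: its elements are the finite sums $\sum_\gamma f_\gamma U_\gamma$ with $f_\gamma\in\mathcal M$, and its product is determined by $(f^0U_\alpha)(f^1U_\beta)=f^0\cdot(f^1|\alpha^{-1})\,U_{\alpha\beta}$. Write $U_\gamma^*=U_{\gamma^{-1}}$. Let $\mathcal H_1$ be the Hopf algebra which, as an algebra, is the universal enveloping algebra of the complex Lie algebra with basis $X$, $Y$, $\delta_n$ $(n\ge1)$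 and brackets $[Y,X]=X$, $[Y,\delta_n]=n\delta_n$, $[X,\delta_n]=\delta_{n+1}$, $[\delta_k,\delta_l]=0$, with the multiplicative coproduct determined by $\Delta Y=Y\otimes1+1\otimes Y$, $\Delta\delta_1=\delta_1\otimes1+1\otimes\delta_1$, $\Delta X=X\otimes1+1\otimes X+\delta_1\otimes Y$. Let $\delta:\mathcal H_1\to\mathbb C$ be the character with $\delta(Y)=1$, $\delta(X)=\delta(\delta_n)=0$. The standard action of $\mathcal H_1$ on $\mathcal A$ is the Hopf action determined, for $f\in\mathcal M_k$ and $\gamma\in\mathrm{GL}^+(2,\mathbb Q)$, by $$Y(fU_\gamma^*)=\tfrac k2\,fU_\gamma^*,\qquad X(fU_\gamma^*)=\frac1{2\pi i}\Big(\frac{df}{dz}-\frac{d\log\eta^4}{dz}\cdot\frac k2 f\Big)U_\gamma^*,\qquad \delta_1(fU_\gamma^*)=\mu_\gamma f\,U_\gamma^*,$$ where $\eta$ is the Dedekind function, $\Delta=\eta^{24}$ and $\mu_\gamma=\frac1{12\pi i}\frac{d}{dz}\log\frac{\Delta|\gamma}{\Delta}\in\mathcal M_2$. Fix $z_0\in\mathbb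 H$. Let $\tau_0:\mathcal A\times\mathcal A\to\mathbb C$ be the bilinear form whose value on $f^0U_{\gamma_0}$, $f^1U_{\gamma_1}$, with $f^0$, $f^1$ homogeneous of weights $w(f^0)$, $w(f^1)$, is $$\tau_0(f^0U_{\gamma_0},f^1U_{\gamma_1})=\int_{z_0}^{\gamma_0z_0}f^0\cdot(f^1|\gamma_1)\,dz\quad\text{if }w(f^0)+w(f^1)=2\text{ and }\gamma_0\gamma_1=1,$$ and $0$ otherwise. **Proposition.** For every $z_0\in\mathbb H$: 1. $\tau_0$ is a cyclic $1$-cocycle on $\mathcal A$: for all $a^0,a^1,a^2\in\mathcal A$ one has $\tau_0(a^0,a^1)=-\tau_0(a^1,a^0)$ and $\tau_0(a^0a^1,a^2)-\tau_0(a^0,a^1a^2)+\tau_0(a^2a^0,a^1)=0$. 2. $\tau_0$ is $\delta$-invariant under the standard action: $\sum\tau_0(h_{(1)}(a^0),h_{(2)}(a^1))=\delta(h)\,\tau_0(a^0,a^1)$ for all $h\in\mathcal H_1$ and $a^0,a^1\in\mathcal A$, where $\Delta h=\sum h_{(1)}\otimes h_{(2)}$. -/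

import Mathlib

open UpperHalfPlane hiding I
open Complex
open scoped MatrixGroups ModularForm Manifold Derivative TensorProduct DirectSum

noncomputable section

namespace ModularSymbol

/-! ### Modular forms of all levels -/

/-- The inclusion of `GL⁺(2, ℚ)` into `GL(2, ℝ)`. -/
def toGLReal : GL(2, ℚ)⁺ →* GL (Fin 2) ℝ :=
  (Matrix.GeneralLinearGroup.map (Rat.castHom ℝ)).comp (Subgroup.subtype _)

theorem toGLReal_det_pos (γ : GL(2, ℚ)⁺) : 0 < (toGLReal γ).det.val := by
  have h : (0 : ℚ) < (γ : GL (Fin 2) ℚ).det.val := γ.2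
  have : (toGLReal γ).det.val = (((γ : GL (Fin 2) ℚ).det.val : ℚ) : ℝ) := by
    simp [toGLReal, Matrix.det_fin_two]
  rw [this]; exact_mod_cast h

/-- `f` is a (holomorphic) modular form of weight `k` for some principal congruence subgroup. -/
def IsModular (k : ℤ) (f : ℍ → ℂ) : Prop :=
  ∃ N : ℕ, N ≠ 0 ∧
    ∃ F : ModularForm ((CongruenceSubgroup.Gamma N).map (Matrix.SpecialLinearGroup.mapGL ℝ)) k,
      (F : ℍ → ℂ) = f

theorem IsModular.mdiff {k : ℤ} {f : ℍ → ℂ} (h : IsModular k f) : MDiff f := by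
  obtain ⟨N, -, F, rfl⟩ := h
  exact F.holo'

theorem IsModular.bdd {k : ℤ} {f : ℍ → ℂ} (h : IsModular k f) (g : SL(2, ℤ)) :
    IsBoundedAtImInfty (f ∣[k] g) := by
  obtain ⟨N, hN, F, rfl⟩ := h
  have : NeZero N := ⟨hN⟩
  exact ModularFormClass.bdd_at_infty_slash F g

theorem IsModular.inv {k : ℤ} {f : ℍ → ℂ} (h : IsModular k f) :
    ∃ N : ℕ, N ≠ 0 ∧ ∀ g ∈ CongruenceSubgroup.Gamma N, f ∣[k] g = f := by
  obtain ⟨N, hN, F, rfl⟩ := h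
  exact ⟨N, hN, fun g hg ↦ F.slash_action_eq' _ (Subgroup.mem_map_of_mem _ hg)⟩

theorem isModular_of {k : ℤ} {f : ℍ → ℂ} (hf : MDiff f)
    (hinv : ∃ N : ℕ, N ≠ 0 ∧ ∀ g ∈ CongruenceSubgroup.Gamma N, f ∣[k] g = f)
    (hb : ∀ g : SL(2, ℤ), IsBoundedAtImInfty (f ∣[k] g)) : IsModular k f := by
  obtain ⟨N, hN, hinv⟩ := hinv
  have : NeZero N := ⟨hN⟩
  refine ⟨N, hN, ⟨⟨f, ?_⟩, hf, ?_⟩, rfl⟩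
  · rintro _ ⟨g, hg, rfl⟩
    exact hinv g hg
  · intro c hc
    rw [Subgroup.IsArithmetic.isCusp_iff_isCusp_SL2Z] at hc
    exact (OnePoint.isBoundedAt_iff_forall_SL2Z hc).mpr fun γ _ ↦ hb γ

theorem gamma_of_dvd {N M : ℕ} (h : N ∣ M) {g : SL(2, ℤ)}
    (hg : g ∈ CongruenceSubgroup.Gamma M) : g ∈ CongruenceSubgroup.Gamma N := by
  rw [CongruenceSubgroup.Gamma_mem] at hg ⊢
  obtain ⟨h1, h2, h3, h4⟩ := hg
  have c {a : ℤ} {b : ZMod M} (hab : (a : ZMod M) = b) : (a : ZMod N) = ZMod.castHom h _ b := by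
    rw [← hab, map_intCast]
  exact ⟨(c h1).trans (map_one _), (c h2).trans (map_zero _), (c h3).trans (map_zero _),
    (c h4).trans (map_one _)⟩

theorem IsModular.add {k : ℤ} {f g : ℍ → ℂ} (hf : IsModular k f) (hg : IsModular k g) :
    IsModular k (f + g) := by
  obtain ⟨N, hN, hN'⟩ := hf.inv
  obtain ⟨M, hM, hM'⟩ := hg.inv
  refine isModular_of (hf.mdiff.add hg.mdiff) ⟨N * M, mul_ne_zero hN hM, fun γ hγ ↦ ?_⟩ fun γ ↦ ?_
  · rw [SlashAction.add_slash, hN' γ (gamma_of_dvd (dvd_mul_right _ _) hγ),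
      hM' γ (gamma_of_dvd (dvd_mul_left _ _) hγ)]
  · rw [SlashAction.add_slash]
    exact (hf.bdd γ).add (hg.bdd γ)

theorem IsModular.mul {k l : ℤ} {f g : ℍ → ℂ} (hf : IsModular k f) (hg : IsModular l g) :
    IsModular (k + l) (f * g) := by
  obtain ⟨N, hN, hN'⟩ := hf.inv
  obtain ⟨M, hM, hM'⟩ := hg.inv
  refine isModular_of (hf.mdiff.mul hg.mdiff) ⟨N * M, mul_ne_zero hN hM, fun γ hγ ↦ ?_⟩ fun γ ↦ ?_
  · rw [ModularForm.mul_slash_SL2, hN' γ (gamma_of_dvd (dvd_mul_right _ _) hγ),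
      hM' γ (gamma_of_dvd (dvd_mul_left _ _) hγ)]
  · rw [ModularForm.mul_slash_SL2]
    exact (hf.bdd γ).mul (hg.bdd γ)

theorem isModular_const (c : ℂ) : IsModular 0 (fun _ ↦ c) := by
  refine isModular_of mdifferentiable_const ⟨1, one_ne_zero, fun γ _ ↦ ?_⟩ fun γ ↦ ?_
  · exact ModularForm.is_invariant_const γ c
  · rw [show ((fun _ ↦ c : ℍ → ℂ) ∣[(0 : ℤ)] γ) = _ from ModularForm.is_invariant_const γ c]
    exact Filter.const_boundedAtFilter _ c

theorem IsModular.smul {k : ℤ} {f : ℍ → ℂ} (c : ℂ) (hf : IsModular k f) :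
    IsModular k (c • f) := by
  have := (isModular_const c).mul hf
  rw [zero_add] at this
  exact this

theorem isModular_zero (k : ℤ) : IsModular k 0 :=
  ⟨1, one_ne_zero, 0, rfl⟩

/-- The space `ℳ_k` of modular forms of weight `k` and of all levels. -/
def formsOfWeight (k : ℤ) : Submodule ℂ (ℍ → ℂ) where
  carrier := {f | IsModular k f}
  add_mem' := IsModular.add
  zero_mem' := isModular_zero k
  smul_mem' c _ := IsModular.smul c

theorem mem_formsOfWeight {k : ℤ} {f : ℍ → ℂ} : f ∈ formsOfWeight k ↔ IsModular k f := Iff.rfl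

instance : SetLike.GradedMonoid formsOfWeight where
  one_mem := isModular_const 1
  mul_mem _ _ _ _ := IsModular.mul

/-- The graded algebra `ℳ = ⨁ ℳ_k` of modular forms of all levels, with pointwise product. -/
def FormAlgebra : Type := ⨁ k : ℤ, formsOfWeight k

instance : CommRing FormAlgebra := inferInstanceAs (CommRing (⨁ k : ℤ, formsOfWeight k))

instance : Algebra ℂ FormAlgebra := inferInstanceAs (Algebra ℂ (⨁ k : ℤ, formsOfWeight k))

/-- A modular form of weight `k`, as a homogeneous element of `ℳ`. -/
def form (k : ℤ) : formsOfWeight k →ₗ[ℂ] FormAlgebra :=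
  DirectSum.lof ℂ ℤ (fun k ↦ formsOfWeight k) k

/-- The component of weight `k` of an element of `ℳ`. -/
def component (k : ℤ) : FormAlgebra →ₗ[ℂ] formsOfWeight k :=
  DirectSum.component ℂ ℤ (fun k ↦ formsOfWeight k) k

/-- The linear map on `ℳ` with given values on the forms of each weight. -/
def liftForm {M : Type*} [AddCommGroup M] [Module ℂ M] (φ : ∀ k : ℤ, formsOfWeight k →ₗ[ℂ] M) :
    FormAlgebra →ₗ[ℂ] M :=
  DirectSum.toModule ℂ ℤ M φ

theorem liftForm_form {M : Type*} [AddCommGroup M] [Module ℂ M]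
    (φ : ∀ k : ℤ, formsOfWeight k →ₗ[ℂ] M) (k : ℤ) (f : formsOfWeight k) :
    liftForm φ (form k f) = φ k f :=
  DirectSum.toModule_lof ℂ (φ := φ) k f

theorem form_induction {p : FormAlgebra → Prop} (x : FormAlgebra) (h0 : p 0)
    (hf : ∀ k f, p (form k f)) (ha : ∀ x y, p x → p y → p (x + y)) : p x :=
  DirectSum.induction_on x h0 hf ha

theorem form_mul_form {k l : ℤ} (f : formsOfWeight k) (g : formsOfWeight l) :
    form k f * form l g = form (k + l) ⟨(f : ℍ → ℂ) * g, IsModular.mul f.2 g.2⟩ :=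
  DirectSum.of_mul_of (A := fun k ↦ formsOfWeight k) _ _

theorem form_one : form 0 ⟨1, isModular_const 1⟩ = 1 := rfl

theorem form_congr {k l : ℤ} (h : k = l) {f : formsOfWeight k} {g : formsOfWeight l}
    (hfg : (f : ℍ → ℂ) = g) : form k f = form l g := by
  subst h
  rw [Subtype.ext hfg]

/-! ### The slash action of `GL⁺(2, ℚ)` -/

/-- The weight `k` action `(f | γ)(z) = det(γ)^{k/2} (c z + d)^{-k} f(γ z)`. -/
def slash (k : ℤ) (γ : GL(2, ℚ)⁺) (f : ℍ → ℂ) (z : ℍ) : ℂ :=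
  (√((toGLReal γ).det.val) : ℂ) ^ k * denom (toGLReal γ) z ^ (-k) * f (toGLReal γ • z)

theorem sqrt_det_ne_zero (γ : GL(2, ℚ)⁺) : ((√((toGLReal γ).det.val) : ℝ) : ℂ) ≠ 0 :=
  ofReal_ne_zero.mpr (Real.sqrt_pos.mpr (toGLReal_det_pos γ)).ne'

/-- The ratio between the normalization of `slash` and that of `SlashAction`. -/
def slashFactor (k : ℤ) (γ : GL(2, ℚ)⁺) : ℂ :=
  (√((toGLReal γ).det.val) : ℂ) ^ k * ((toGLReal γ).det.val : ℂ) ^ (1 - k)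

theorem slash_eq (k : ℤ) (γ : GL(2, ℚ)⁺) (f : ℍ → ℂ) :
    slash k γ f = slashFactor k γ • (f ∣[k] toGLReal γ) := by
  ext z
  have h := toGLReal_det_pos γ
  have h' : ((toGLReal γ).det.val : ℂ) ≠ 0 := ofReal_ne_zero.mpr h.ne'
  simp only [slash, Pi.smul_apply, smul_eq_mul, slashFactor, ModularForm.slash_apply,
    UpperHalfPlane.σ, if_pos h, abs_of_pos h]
  have hk := zpow_ne_zero (k - 1) h'
  rw [show (1 - k : ℤ) = -(k - 1) by ring,
    zpow_neg ((toGLReal γ).det.val : ℂ) (k - 1)]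
  simp only [ContinuousAlgEquiv.refl_apply]
  generalize ((toGLReal γ).det.val : ℂ) ^ (k - 1) = d at hk
  field_simp

theorem slash_one (k : ℤ) (f : ℍ → ℂ) : slash k 1 f = f := by
  rw [slash_eq, map_one, SlashAction.slash_one]
  simp [slashFactor]

theorem slash_mul (k : ℤ) (α β : GL(2, ℚ)⁺) (f : ℍ → ℂ) :
    slash k (α * β) f = slash k β (slash k α f) := by
  have hf : slashFactor k (α * β) = slashFactor k β * slashFactor k α := by
    simp only [slashFactor, map_mul, Units.val_mul]
    rw [Real.sqrt_mul (toGLReal_det_pos α).le, ofReal_mul, ofReal_mul, mul_zpow, mul_zpow]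
    ring
  have hσ : UpperHalfPlane.σ (toGLReal β) = ContinuousAlgEquiv.refl ℝ ℂ := by
    simp only [UpperHalfPlane.σ, if_pos (toGLReal_det_pos β)]
  rw [slash_eq, slash_eq, slash_eq, map_mul, SlashAction.slash_mul, ModularForm.smul_slash,
    hσ, hf, mul_smul]
  rfl

theorem slash_add (k : ℤ) (γ : GL(2, ℚ)⁺) (f g : ℍ → ℂ) :
    slash k γ (f + g) = slash k γ f + slash k γ g := by
  ext z; simp [slash, mul_add]

theorem slash_smul (k : ℤ) (γ : GL(2, ℚ)⁺) (c : ℂ) (f : ℍ → ℂ) :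
    slash k γ (c • f) = c • slash k γ f := by
  ext z; simp only [slash, Pi.smul_apply, smul_eq_mul]; ring

theorem slash_prod (k l : ℤ) (γ : GL(2, ℚ)⁺) (f g : ℍ → ℂ) :
    slash (k + l) γ (f * g) = slash k γ f * slash l γ g := by
  ext z
  simp only [slash, Pi.mul_apply, neg_add, zpow_add₀ (sqrt_det_ne_zero γ),
    zpow_add₀ (denom_ne_zero (toGLReal γ) z)]
  ring

theorem slash_const_one (γ : GL(2, ℚ)⁺) : slash 0 γ 1 = 1 := by
  ext z; simp [slash]

open Matrix.SpecialLinearGroup in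
/-- Every congruence subgroup contains the conjugate of another one by an element of
`GL⁺(2, ℚ)`. -/
theorem exists_gamma_conj (γ : GL(2, ℚ)⁺) (M : ℕ) (hM : M ≠ 0) :
    ∃ N : ℕ, N ≠ 0 ∧ ∀ x ∈ CongruenceSubgroup.Gamma N, ∃ y ∈ CongruenceSubgroup.Gamma M,
      toGLReal γ * mapGL ℝ x = mapGL ℝ y * toGLReal γ := by
  have : NeZero M := ⟨hM⟩
  obtain ⟨N, hN, h⟩ := CongruenceSubgroup.exists_Gamma_le_conj (γ : GL (Fin 2) ℚ) M
  refine ⟨N, hN, fun x hx ↦ ?_⟩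
  obtain ⟨y, hy, hxy⟩ := h x hx
  refine ⟨y, hy, ?_⟩
  have h2 : (γ : GL (Fin 2) ℚ) * mapGL ℚ x = mapGL ℚ y * γ := by
    rw [hxy]; group
  have h3 := congrArg (Matrix.GeneralLinearGroup.map (Rat.castHom ℝ)) h2
  rw [map_mul, map_mul] at h3
  have hm (x : SL(2, ℤ)) :
      Matrix.GeneralLinearGroup.map (Rat.castHom ℝ) (mapGL ℚ x) = mapGL ℝ x := by
    ext i j; simp
  rw [hm, hm] at h3
  exact h3

open Matrix.SpecialLinearGroup in
/-- `GL⁺(2, ℚ) = SL(2, ℤ) · {upper triangular matrices}`. -/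
theorem exists_upper (γ : GL(2, ℚ)⁺) :
    ∃ (g : SL(2, ℤ)) (T : GL(2, ℚ)⁺), toGLReal γ = mapGL ℝ g * toGLReal T ∧
      toGLReal T 1 0 = 0 := by
  obtain ⟨g, hg⟩ := OnePoint.exists_mem_SL2 ℤ ((γ : GL (Fin 2) ℚ) • (OnePoint.infty : OnePoint ℚ))
  have hdet : (mapGL ℚ g) ∈ GL(2, ℚ)⁺ := by
    rw [Matrix.mem_glpos]; simp
  refine ⟨g, ⟨mapGL ℚ g, hdet⟩⁻¹ * γ, ?_, ?_⟩
  · have hm : mapGL ℝ g = toGLReal ⟨mapGL ℚ g, hdet⟩ := by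
      ext i j; simp [toGLReal]
    rw [hm, ← map_mul, mul_inv_cancel_left]
  · have h1 : ((mapGL ℚ g)⁻¹ * (γ : GL (Fin 2) ℚ)) • (OnePoint.infty : OnePoint ℚ)
        = OnePoint.infty := by
      rw [mul_smul, ← hg, inv_smul_smul]
    have h2 := OnePoint.smul_infty_eq_self_iff.mp h1
    have h3 : (toGLReal (⟨mapGL ℚ g, hdet⟩⁻¹ * γ)) 1 0 =
        ((((mapGL ℚ g)⁻¹ * (γ : GL (Fin 2) ℚ)) 1 0 : ℚ) : ℝ) := rfl
    rw [h3, h2, Rat.cast_zero]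

theorem IsModular.slash {k : ℤ} {f : ℍ → ℂ} (hf : IsModular k f) (γ : GL(2, ℚ)⁺) :
    IsModular k (slash k γ f) := by
  rw [slash_eq]
  refine IsModular.smul _ (isModular_of (hf.mdiff.slash k _) ?_ fun g ↦ ?_)
  · obtain ⟨M, hM, hinv⟩ := hf.inv
    obtain ⟨N, hN, h⟩ := exists_gamma_conj γ M hM
    refine ⟨N, hN, fun x hx ↦ ?_⟩
    obtain ⟨y, hy, hxy⟩ := h x hx
    rw [ModularForm.SL_slash]
    erw [← SlashAction.slash_mul, hxy, SlashAction.slash_mul]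
    exact congrArg (· ∣[k] toGLReal γ) (hinv y hy)
  · have hdet : (Matrix.SpecialLinearGroup.mapGL ℚ g) ∈ GL(2, ℚ)⁺ := by
      rw [Matrix.mem_glpos]; simp
    have hm : Matrix.SpecialLinearGroup.mapGL ℝ g =
        toGLReal ⟨Matrix.SpecialLinearGroup.mapGL ℚ g, hdet⟩ := by
      ext i j; simp [toGLReal]
    obtain ⟨g', T, h1, h2⟩ := exists_upper (γ * ⟨Matrix.SpecialLinearGroup.mapGL ℚ g, hdet⟩)
    rw [map_mul, ← hm] at h1
    rw [ModularForm.SL_slash]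
    erw [← SlashAction.slash_mul, h1, SlashAction.slash_mul]
    exact (hf.bdd g').slash k h2


theorem toGLReal_val_det_pos (γ : GL(2, ℚ)⁺) : 0 < (toGLReal γ).val.det := by
  have := toGLReal_det_pos γ
  rwa [Matrix.GeneralLinearGroup.val_det_apply] at this

/-! ### The operators `Y`, `X` and the forms `μ_γ` -/

/-- The Ramanujan connection on forms of weight `k`:
`X f = (2πi)⁻¹ f' - (2πi)⁻¹ (log η⁴)' · (k / 2) f`. -/
def ramanujan (k : ℤ) (f : ℍ → ℂ) (z : ℍ) : ℂ :=
  (2 * Real.pi * I)⁻¹ * deriv (f ∘ ofComplex) z -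
    (2 * Real.pi * I)⁻¹ * logDeriv (fun w : ℂ ↦ ModularForm.eta w ^ 4) z * ((k : ℂ) / 2 * f z)

/-- `μ_γ = (12πi)⁻¹ (d/dz) log ((Δ | γ) / Δ)`. -/
def mu (γ : GL(2, ℚ)⁺) (z : ℍ) : ℂ :=
  (12 * Real.pi * I)⁻¹ *
    logDeriv (fun w : ℂ ↦ slash 12 γ ModularForm.discriminant (ofComplex w) /
      ModularForm.discriminant (ofComplex w)) z

theorem ramanujan_eq (k : ℤ) (f : ℍ → ℂ) :
    ramanujan k f = Derivative.serreDerivative k f := by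
  ext z
  have hd : DifferentiableAt ℂ ModularForm.eta (z : ℂ) :=
    ModularForm.differentiableAt_eta_of_mem_upperHalfPlaneSet z.2
  have hl : logDeriv (fun w : ℂ ↦ ModularForm.eta w ^ 4) z =
      4 * ((Real.pi * I / 12) * EisensteinSeries.E2 z) := by
    rw [← ModularForm.logDeriv_eta_eq_E2, logDeriv_fun_pow hd]
    norm_num
  rw [ramanujan, Derivative.serreDerivative_apply, Derivative.normalizedDerivOfComplex, hl]
  have hpi : (Real.pi : ℂ) ≠ 0 := ofReal_ne_zero.mpr Real.pi_ne_zero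
  field_simp
  ring

theorem mdiff_discriminant : MDiff ModularForm.discriminant :=
  CuspForm.discriminant.holo'

/-- The logarithmic derivative of a slashed function. -/
theorem logD_slash {k : ℤ} {F : ℍ → ℂ} (hF : MDiff F) (hF0 : ∀ z, F z ≠ 0)
    (γ : GL(2, ℚ)⁺) :
    D (F ∣[k] toGLReal γ) / (F ∣[k] toGLReal γ) = ((D F / F) ∣[(2 : ℤ)] toGLReal γ) -
      fun z : ℍ ↦ (k : ℂ) * (2 * Real.pi * I)⁻¹ * (toGLReal γ 1 0 / denom (toGLReal γ) z) := by
  have hdet := toGLReal_val_det_pos γ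
  have h' := toGLReal_det_pos γ
  ext z
  rw [Pi.div_apply, Derivative.normalizedDerivOfComplex_slash hF hdet]
  have hz := denom_ne_zero (toGLReal γ) z
  have hd : ((toGLReal γ).val.det : ℂ) ≠ 0 := ofReal_ne_zero.mpr hdet.ne'
  have hσ (x) : UpperHalfPlane.σ (toGLReal γ) x = x := by
    simp only [UpperHalfPlane.σ, if_pos h', ContinuousAlgEquiv.refl_apply]
  have hFz := hF0 (toGLReal γ • z)
  simp only [Pi.sub_apply, ModularForm.slash_apply, hσ, Pi.div_apply,
    Matrix.GeneralLinearGroup.val_det_apply, abs_of_pos hdet]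
  rw [show k + 2 - 1 = (k - 1) + 2 by ring, show -(k + 2) = -k + -2 by ring,
    zpow_add₀ hd, zpow_add₀ hz]
  have h1 := zpow_ne_zero (k - 1) hd
  have h2 := zpow_ne_zero (-k) hz
  generalize ((toGLReal γ).val.det : ℂ) ^ (k - 1) = A at *
  generalize denom (toGLReal γ) z ^ (-k) = B at *
  rw [show (2 : ℤ) - 1 = 1 by norm_num, zpow_one]
  generalize (2 * Real.pi * I : ℂ)⁻¹ = P
  generalize denom (toGLReal γ) z ^ (-2 : ℤ) = Q
  generalize (toGLReal γ 1 0 : ℂ) / denom (toGLReal γ) z = R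
  generalize ((toGLReal γ).val.det : ℂ) = S at *
  field_simp

theorem slash_discriminant_ne_zero (γ : GL(2, ℚ)⁺) (z : ℍ) :
    (ModularForm.discriminant ∣[(12 : ℤ)] toGLReal γ) z ≠ 0 := by
  have h' := toGLReal_det_pos γ
  have hσ (x) : UpperHalfPlane.σ (toGLReal γ) x = x := by
    simp only [UpperHalfPlane.σ, if_pos h', ContinuousAlgEquiv.refl_apply]
  rw [ModularForm.slash_apply, hσ]
  exact mul_ne_zero (mul_ne_zero (ModularForm.discriminant_ne_zero _)
    (zpow_ne_zero _ (ofReal_ne_zero.mpr (abs_pos.mpr h'.ne').ne')))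
    (zpow_ne_zero _ (denom_ne_zero _ _))

theorem mu_eq (γ : GL(2, ℚ)⁺) :
    mu γ = (6 : ℂ)⁻¹ • (D (ModularForm.discriminant ∣[(12 : ℤ)] toGLReal γ) /
      (ModularForm.discriminant ∣[(12 : ℤ)] toGLReal γ) -
        D ModularForm.discriminant / ModularForm.discriminant) := by
  ext z
  set Δ := ModularForm.discriminant
  set Δ' := Δ ∣[(12 : ℤ)] toGLReal γ with hΔ'
  have h0 : ∀ z, Δ z ≠ 0 := ModularForm.discriminant_ne_zero
  have h0' : ∀ z, Δ' z ≠ 0 := slash_discriminant_ne_zero γ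
  have hd : DifferentiableAt ℂ (Δ ∘ ofComplex) z :=
    UpperHalfPlane.mdifferentiableAt_iff.mp (mdiff_discriminant z)
  have hd' : DifferentiableAt ℂ (Δ' ∘ ofComplex) z := UpperHalfPlane.mdifferentiableAt_iff.mp
    ((mdiff_discriminant.slash 12 (toGLReal γ)) z)
  have hc : slashFactor 12 γ ≠ 0 :=
    mul_ne_zero (zpow_ne_zero _ (sqrt_det_ne_zero γ))
      (zpow_ne_zero _ (ofReal_ne_zero.mpr (toGLReal_det_pos γ).ne'))
  have e : (fun w : ℂ ↦ slash 12 γ Δ (ofComplex w) / Δ (ofComplex w)) =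
      fun w ↦ slashFactor 12 γ * ((Δ' ∘ ofComplex) w / (Δ ∘ ofComplex) w) := by
    ext w
    rw [slash_eq]
    simp only [Pi.smul_apply, smul_eq_mul, Function.comp_apply, hΔ', mul_div_assoc]
  have hpi : (Real.pi : ℂ) ≠ 0 := ofReal_ne_zero.mpr Real.pi_ne_zero
  rw [mu, e, logDeriv_const_mul _ _ hc, logDeriv_div _ (by simpa using h0' z) (by simpa using h0 z)
    hd' hd]
  simp only [logDeriv_apply, Function.comp_apply, ofComplex_apply, Pi.smul_apply, Pi.sub_apply,
    Pi.div_apply, Derivative.normalizedDerivOfComplex, smul_eq_mul]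
  have hz := h0 z
  have hz' := h0' z
  field_simp
  ring

/-- The cocycle property `μ_{αβ} = μ_α | β + μ_β`. -/
theorem mu_mul (α β : GL(2, ℚ)⁺) :
    mu (α * β) = (mu α ∣[(2 : ℤ)] toGLReal β) + mu β := by
  have h := logD_slash (k := 12) mdiff_discriminant ModularForm.discriminant_ne_zero β
  have h2 := logD_slash (k := 12) (mdiff_discriminant.slash 12 (toGLReal α))
    (slash_discriminant_ne_zero α) β
  rw [← SlashAction.slash_mul, ← map_mul] at h2
  have hσ (x) : UpperHalfPlane.σ (toGLReal β) x = x := by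
    simp only [UpperHalfPlane.σ, if_pos (toGLReal_det_pos β), ContinuousAlgEquiv.refl_apply]
  rw [mu_eq, mu_eq, mu_eq, ModularForm.smul_slash, hσ, h, h2, sub_eq_add_neg (D _ / _),
    SlashAction.add_slash, SlashAction.neg_slash, ← smul_add]
  congr 1
  abel

/-- Elements of `SL(2, ℤ)` as elements of `GL⁺(2, ℚ)`. -/
def ofSLZ (g : SL(2, ℤ)) : GL(2, ℚ)⁺ :=
  ⟨Matrix.SpecialLinearGroup.mapGL ℚ g, by rw [Matrix.mem_glpos]; simp⟩

theorem toGLReal_ofSLZ (g : SL(2, ℤ)) :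
    toGLReal (ofSLZ g) = Matrix.SpecialLinearGroup.mapGL ℝ g := by
  ext i j; simp [toGLReal, ofSLZ]

theorem mu_ofSLZ (g : SL(2, ℤ)) : mu (ofSLZ g) = 0 := by
  have : ModularForm.discriminant ∣[(12 : ℤ)] toGLReal (ofSLZ g) = ModularForm.discriminant := by
    rw [toGLReal_ofSLZ]
    exact CuspForm.discriminant.slash_action_eq' _ ⟨g, rfl⟩
  rw [mu_eq, this, sub_self, smul_zero]

theorem toGLReal_injective : Function.Injective toGLReal := by
  intro a b h
  ext i j
  have := congrArg (fun g : GL (Fin 2) ℝ ↦ g i j) h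
  exact Rat.cast_injective (α := ℝ) this

theorem logD_discriminant :
    D ModularForm.discriminant / ModularForm.discriminant = EisensteinSeries.E2 := by
  ext z
  have hd : DifferentiableAt ℂ ModularForm.eta (z : ℂ) :=
    ModularForm.differentiableAt_eta_of_mem_upperHalfPlaneSet z.2
  have e : ModularForm.discriminant ∘ ofComplex =ᶠ[nhds (z : ℂ)]
      fun w ↦ ModularForm.eta w ^ 24 := by
    filter_upwards [isOpen_upperHalfPlaneSet.mem_nhds z.2] with w hw
    simp [ModularForm.discriminant, ofComplex_apply_of_im_pos hw]
  have hl := ModularForm.logDeriv_eta_eq_E2 z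
  rw [logDeriv_apply] at hl
  have h0 := ModularForm.eta_ne_zero z.2
  have hpi : (Real.pi : ℂ) ≠ 0 := ofReal_ne_zero.mpr Real.pi_ne_zero
  rw [div_eq_iff h0] at hl
  rw [Pi.div_apply, Derivative.normalizedDerivOfComplex, e.deriv_eq, deriv_fun_pow hd, hl,
    ModularForm.discriminant]
  field_simp
  norm_num
  ring

theorem isModular_mu (γ : GL(2, ℚ)⁺) : IsModular 2 (mu γ) := by
  have key (g : SL(2, ℤ)) : mu γ ∣[(2 : ℤ)] g = mu (γ * ofSLZ g) := by
    rw [mu_mul, mu_ofSLZ, add_zero, toGLReal_ofSLZ]; rfl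
  refine isModular_of ?_ ?_ fun g ↦ ?_
  · rw [mu_eq, logD_slash mdiff_discriminant ModularForm.discriminant_ne_zero, logD_discriminant]
    rw [← logD_discriminant]
    refine MDifferentiable.const_smul _ (.sub (.sub ?_ ?_) ?_)
    · rw [logD_discriminant]
      exact E2_mdifferentiable.slash 2 _
    · have h1 := (mdifferentiable_denom_zpow (toGLReal γ) (-1)).const_smul
        (((12 : ℤ) : ℂ) * (2 * Real.pi * I)⁻¹ * (toGLReal γ 1 0 : ℂ))
      have e : (fun z : ℍ ↦ ((12 : ℤ) : ℂ) * (2 * Real.pi * I)⁻¹ *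
          (toGLReal γ 1 0 / denom (toGLReal γ) z)) = (((12 : ℤ) : ℂ) * (2 * Real.pi * I)⁻¹ *
            (toGLReal γ 1 0 : ℂ)) • fun z : ℍ ↦ denom (toGLReal γ) z ^ (-1 : ℤ) := by
        ext z
        simp [div_eq_mul_inv, mul_assoc]
      rw [e]
      exact h1
    · rw [logD_discriminant]
      exact E2_mdifferentiable
  · obtain ⟨N, hN, h⟩ := exists_gamma_conj γ 1 one_ne_zero
    refine ⟨N, hN, fun x hx ↦ ?_⟩
    obtain ⟨y, -, hxy⟩ := h x hx
    have : γ * ofSLZ x = ofSLZ y * γ := toGLReal_injective (by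
      rw [map_mul, map_mul, toGLReal_ofSLZ, toGLReal_ofSLZ, hxy])
    rw [key, this, mu_mul, mu_ofSLZ, SlashAction.zero_slash, zero_add]
  · obtain ⟨g', T, h1, h2⟩ := exists_upper (γ * ofSLZ g)
    have : γ * ofSLZ g = ofSLZ g' * T := toGLReal_injective (by
      rw [h1, map_mul, toGLReal_ofSLZ])
    rw [key, this, mu_mul, mu_ofSLZ, SlashAction.zero_slash, zero_add, mu_eq,
      logD_slash mdiff_discriminant ModularForm.discriminant_ne_zero, logD_discriminant, h2]
    have hE := EisensteinSeries.isBoundedAtImInfty_E2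
    simp only [ofReal_zero, zero_div, mul_zero]
    have h3 : Filter.BoundedAtFilter atImInfty (fun _ : ℍ ↦ (0 : ℂ)) :=
      Filter.const_boundedAtFilter _ 0
    exact Filter.BoundedAtFilter.smul (6 : ℂ)⁻¹ (((hE.slash 2 h2).sub h3).sub hE)

theorem isBounded_deriv {f : ℍ → ℂ} (hf : MDiff f) (hb : IsBoundedAtImInfty f) :
    IsBoundedAtImInfty (D f) := by
  rw [isBoundedAtImInfty_iff] at hb ⊢
  obtain ⟨M, A, h⟩ := hb
  refine ⟨‖(2 * Real.pi * I : ℂ)⁻¹‖ * (M / 1), max A 0 + 2, fun z hz ↦ ?_⟩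
  rw [Derivative.normalizedDerivOfComplex, norm_mul]
  have him (w : ℂ) (hw : w ∈ Metric.closedBall (z : ℂ) 1) : max A 0 + 1 ≤ w.im := by
    have h1 := (abs_im_le_norm (w - z)).trans (mem_closedBall_iff_norm.mp hw)
    rw [sub_im] at h1
    have h2 := (abs_le.mp h1).1
    have h3 : (z : ℂ).im = z.im := rfl
    linarith
  refine mul_le_mul_of_nonneg_left ?_ (norm_nonneg _)
  refine norm_deriv_le_of_forall_mem_sphere_norm_le one_pos ?_ fun w hw ↦ ?_
  · refine (UpperHalfPlane.mdifferentiable_iff.mp hf).diffContOnCl_ball fun w hw ↦ ?_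
    have := him w hw
    have := le_max_right A 0
    change 0 < w.im
    linarith
  · have := him w (Metric.sphere_subset_closedBall hw)
    have h0 : 0 < w.im := by have := le_max_right A 0; linarith
    rw [Function.comp_apply, ofComplex_apply_of_im_pos h0]
    refine h _ ?_
    have := le_max_left A 0
    change A ≤ w.im
    linarith

theorem IsModular.ramanujan {k : ℤ} {f : ℍ → ℂ} (hf : IsModular k f) :
    IsModular (k + 2) (ramanujan k f) := by
  rw [ramanujan_eq]
  refine isModular_of (Derivative.serreDerivative_mdifferentiable _ hf.mdiff) ?_ fun g ↦ ?_
  · obtain ⟨N, hN, h⟩ := hf.inv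
    exact ⟨N, hN, fun g hg ↦ Derivative.serreDerivative_slash_invariant hf.mdiff (h g hg)⟩
  · rw [Derivative.serreDerivative_slash_equivariant hf.mdiff]
    refine (isBounded_deriv (hf.mdiff.slash k _) (hf.bdd g)).sub ?_
    exact ((Filter.const_boundedAtFilter _ _).mul EisensteinSeries.isBoundedAtImInfty_E2).mul
      (hf.bdd g)


/-! ### The action of `GL⁺(2, ℚ)` on `ℳ`, and the crossed product -/

/-- `f ↦ f | γ` on forms of weight `k`. -/
def slashForm (k : ℤ) (γ : GL(2, ℚ)⁺) : formsOfWeight k →ₗ[ℂ] formsOfWeight k where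
  toFun f := ⟨slash k γ f, f.2.slash γ⟩
  map_add' f g := Subtype.ext (slash_add k γ f g)
  map_smul' c f := Subtype.ext (slash_smul k γ c f)

/-- `f ↦ f | γ` on `ℳ`, the weight `k` action on each `ℳ_k`. -/
def slashLin (γ : GL(2, ℚ)⁺) : FormAlgebra →ₗ[ℂ] FormAlgebra :=
  liftForm fun k ↦ form k ∘ₗ slashForm k γ

theorem slashLin_form (γ : GL(2, ℚ)⁺) (k : ℤ) (f : formsOfWeight k) :
    slashLin γ (form k f) = form k (slashForm k γ f) :=
  liftForm_form _ k f

theorem slashLin_map_one (γ : GL(2, ℚ)⁺) : slashLin γ 1 = 1 := by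
  rw [← form_one, slashLin_form]
  exact form_congr rfl (slash_const_one γ)

theorem slashLin_map_mul (γ : GL(2, ℚ)⁺) (x y : FormAlgebra) :
    slashLin γ (x * y) = slashLin γ x * slashLin γ y := by
  induction x using form_induction with
  | h0 => simp
  | ha a b h1 h2 => simp only [add_mul, map_add, h1, h2]
  | hf k f =>
    induction y using form_induction with
    | h0 => simp
    | ha a b h1 h2 => simp only [mul_add, map_add, h1, h2]
    | hf l g =>
      rw [form_mul_form, slashLin_form, slashLin_form, slashLin_form, form_mul_form]
      exact form_congr rfl (slash_prod k l γ f g)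

theorem slashLin_one (x : FormAlgebra) : slashLin 1 x = x := by
  induction x using form_induction with
  | h0 => simp
  | ha a b h1 h2 => simp only [map_add, h1, h2]
  | hf k f =>
    rw [slashLin_form]
    exact form_congr rfl (slash_one k f)

theorem slashLin_mul (α β : GL(2, ℚ)⁺) (x : FormAlgebra) :
    slashLin (α * β) x = slashLin β (slashLin α x) := by
  induction x using form_induction with
  | h0 => simp
  | ha a b h1 h2 => simp only [map_add, h1, h2]
  | hf k f =>
    rw [slashLin_form, slashLin_form, slashLin_form]
    exact form_congr rfl (slash_mul k α β f)

/-- The left action `γ • f = f | γ⁻¹` of `GL⁺(2, ℚ)` on `ℳ`. -/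
instance : MulSemiringAction GL(2, ℚ)⁺ FormAlgebra where
  smul γ f := slashLin γ⁻¹ f
  one_smul f := by
    change slashLin 1⁻¹ f = f
    rw [inv_one, slashLin_one]
  mul_smul α β f := by
    change slashLin (α * β)⁻¹ f = slashLin α⁻¹ (slashLin β⁻¹ f)
    rw [mul_inv_rev, slashLin_mul]
  smul_zero γ := map_zero (slashLin γ⁻¹)
  smul_add γ := map_add (slashLin γ⁻¹)
  smul_one γ := slashLin_map_one γ⁻¹
  smul_mul γ := slashLin_map_mul γ⁻¹

theorem smul_def (γ : GL(2, ℚ)⁺) (f : FormAlgebra) : γ • f = slashLin γ⁻¹ f := rfl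

/-- The crossed product `𝒜 = ℳ ⋊ GL⁺(2, ℚ)`: finite sums `∑ f_γ U_γ` with
`(f U_α) (g U_β) = f · (g | α⁻¹) U_{αβ}`. -/
abbrev CrossedProduct : Type := SkewMonoidAlgebra FormAlgebra GL(2, ℚ)⁺

/-- The monomial `f U_γ`. -/
abbrev mono (f : FormAlgebra) (γ : GL(2, ℚ)⁺) : CrossedProduct := SkewMonoidAlgebra.single γ f

theorem mono_mul_mono (f g : FormAlgebra) (α β : GL(2, ℚ)⁺) :
    mono f α * mono g β = mono (f * slashLin α⁻¹ g) (α * β) :=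
  SkewMonoidAlgebra.single_mul_single

/-! ### The operators of the standard action -/

/-- `Y f = (k / 2) f` for `f` of weight `k`. -/
def opY : Module.End ℂ FormAlgebra :=
  liftForm fun k ↦ ((k : ℂ) / 2) • form k

/-- The Ramanujan connection, from forms of weight `k` to forms of weight `k + 2`. -/
def ramanujanForm (k : ℤ) : formsOfWeight k →ₗ[ℂ] formsOfWeight (k + 2) where
  toFun f := ⟨ramanujan k f, f.2.ramanujan⟩
  map_add' f g := Subtype.ext (by
    simp only [ramanujan_eq]
    exact Derivative.serreDerivative_add _ _ _ f.2.mdiff g.2.mdiff)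
  map_smul' c f := Subtype.ext (by
    simp only [ramanujan_eq]
    exact Derivative.serreDerivative_smul _ _ _ f.2.mdiff)

/-- The operator `X` on `ℳ`. -/
def opX : Module.End ℂ FormAlgebra :=
  liftForm fun k ↦ form (k + 2) ∘ₗ ramanujanForm k

/-- `μ_γ` as an element of `ℳ_2 ⊆ ℳ`. -/
def muForm (γ : GL(2, ℚ)⁺) : FormAlgebra := form 2 ⟨mu γ, isModular_mu γ⟩

theorem opY_form (k : ℤ) (f : formsOfWeight k) : opY (form k f) = ((k : ℂ) / 2) • form k f :=
  liftForm_form _ k f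

theorem opX_form (k : ℤ) (f : formsOfWeight k) :
    opX (form k f) = form (k + 2) (ramanujanForm k f) :=
  liftForm_form _ k f

theorem opY_mul (x y : FormAlgebra) : opY (x * y) = opY x * y + x * opY y := by
  induction x using form_induction with
  | h0 => simp
  | ha a b h1 h2 => simp only [add_mul, map_add, h1, h2]; abel
  | hf k f =>
    induction y using form_induction with
    | h0 => simp
    | ha a b h1 h2 => simp only [mul_add, map_add, h1, h2]; abel
    | hf l g =>
      rw [form_mul_form, opY_form, opY_form, opY_form, smul_mul_assoc, mul_smul_comm,
        form_mul_form, ← add_smul]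
      push_cast
      ring_nf

theorem opX_mul (x y : FormAlgebra) : opX (x * y) = opX x * y + x * opX y := by
  induction x using form_induction with
  | h0 => simp
  | ha a b h1 h2 => simp only [add_mul, map_add, h1, h2]; abel
  | hf k f =>
    induction y using form_induction with
    | h0 => simp
    | ha a b h1 h2 => simp only [mul_add, map_add, h1, h2]; abel
    | hf l g =>
      rw [form_mul_form, opX_form, opX_form, opX_form, form_mul_form, form_mul_form]
      have e1 : k + 2 + l = k + l + 2 := by ring
      have e2 : k + (l + 2) = k + l + 2 := by ring
      have m1 : IsModular (k + l + 2) (ramanujan k f * g) := e1 ▸ f.2.ramanujan.mul g.2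
      have m2 : IsModular (k + l + 2) (f * ramanujan l g) := e2 ▸ f.2.mul g.2.ramanujan
      rw [form_congr e1 (g := ⟨_, m1⟩) rfl, form_congr e2 (g := ⟨_, m2⟩) rfl, ← map_add]
      refine form_congr rfl ?_
      change ramanujan (k + l) (f * g) = ramanujan k f * g + f * ramanujan l g
      rw [ramanujan_eq, ramanujan_eq, ramanujan_eq, Int.cast_add]
      exact Derivative.serreDerivative_mul _ _ _ _ f.2.mdiff g.2.mdiff

theorem opY_opX (x : FormAlgebra) : opY (opX x) = opX (opY x) + opX x := by
  induction x using form_induction with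
  | h0 => simp
  | ha a b h1 h2 => simp only [map_add, h1, h2]; abel
  | hf k f =>
    rw [opX_form, opY_form, opY_form, map_smul, opX_form]
    push_cast
    module

/-- The forms `X^n (μ_γ)`, of weight `2 (n + 1)`. -/
def muIter (γ : GL(2, ℚ)⁺) (n : ℕ) : FormAlgebra := (opX ^ n) (muForm γ)

theorem opX_muIter (γ : GL(2, ℚ)⁺) (n : ℕ) : opX (muIter γ n) = muIter γ (n + 1) := by
  rw [muIter, muIter, pow_succ']; rfl

theorem opY_muIter (γ : GL(2, ℚ)⁺) (n : ℕ) :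
    opY (muIter γ n) = ((n : ℂ) + 1) • muIter γ n := by
  induction n with
  | zero =>
    change opY (muForm γ) = ((0 : ℕ) + 1 : ℂ) • muForm γ
    rw [muForm, opY_form]
    norm_num
  | succ n ih =>
    rw [← opX_muIter, opY_opX, ih, map_smul]
    push_cast
    module

/-- The coefficients of an element of `𝒜`. -/
def coeffEquiv : CrossedProduct ≃ₗ[ℂ] (GL(2, ℚ)⁺ →₀ FormAlgebra) :=
  SkewMonoidAlgebra.coeffLinearEquiv (S := ℂ)

/-- The linear map on `𝒜` with given values on the monomials `f U_γ`. -/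
def liftCross {M : Type*} [AddCommGroup M] [Module ℂ M] (φ : GL(2, ℚ)⁺ → FormAlgebra →ₗ[ℂ] M) :
    CrossedProduct →ₗ[ℂ] M :=
  Finsupp.lsum ℂ φ ∘ₗ coeffEquiv.toLinearMap

theorem liftCross_mono {M : Type*} [AddCommGroup M] [Module ℂ M]
    (φ : GL(2, ℚ)⁺ → FormAlgebra →ₗ[ℂ] M) (f : FormAlgebra) (γ : GL(2, ℚ)⁺) :
    liftCross φ (mono f γ) = φ γ f := by
  refine (Finsupp.lsum_single ℂ φ γ f)

/-- `f ↦ f U_γ` as a linear map. -/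
def monoLin (γ : GL(2, ℚ)⁺) : FormAlgebra →ₗ[ℂ] CrossedProduct :=
  coeffEquiv.symm.toLinearMap ∘ₗ Finsupp.lsingle γ

theorem monoLin_apply (γ : GL(2, ℚ)⁺) (f : FormAlgebra) : monoLin γ f = mono f γ := rfl

theorem cross_ext {M : Type*} [AddCommGroup M] [Module ℂ M] {φ ψ : CrossedProduct →ₗ[ℂ] M}
    (h : ∀ f γ, φ (mono f γ) = ψ (mono f γ)) : φ = ψ := by
  refine LinearMap.toAddMonoidHom_injective (SkewMonoidAlgebra.addHom_ext fun γ f ↦ h f γ)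

/-- An operator acting on each component of `𝒜`: `f U_γ ↦ T_γ (f) U_γ`. -/
def componentwise : (GL(2, ℚ)⁺ → Module.End ℂ FormAlgebra) →ₐ[ℂ] Module.End ℂ CrossedProduct where
  toFun T := liftCross fun γ ↦ monoLin γ ∘ₗ T γ
  map_one' := cross_ext fun f γ ↦ by rw [liftCross_mono]; rfl
  map_mul' S T := cross_ext fun f γ ↦ by
    rw [Module.End.mul_apply, liftCross_mono, liftCross_mono, LinearMap.comp_apply,
      LinearMap.comp_apply, monoLin_apply, monoLin_apply, liftCross_mono]
    rfl
  map_zero' := cross_ext fun f γ ↦ by rw [liftCross_mono]; exact map_zero (monoLin γ)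
  map_add' S T := cross_ext fun f γ ↦ by
    rw [LinearMap.add_apply, liftCross_mono, liftCross_mono, liftCross_mono]
    exact map_add (monoLin γ) _ _
  commutes' c := cross_ext fun f γ ↦ by
    rw [liftCross_mono]; exact map_smul (monoLin γ) c f

theorem componentwise_mono (T : GL(2, ℚ)⁺ → Module.End ℂ FormAlgebra) (f : FormAlgebra)
    (γ : GL(2, ℚ)⁺) : componentwise T (mono f γ) = mono (T γ f) γ :=
  liftCross_mono _ f γ

/-! ### The Hopf algebra `ℋ₁` -/

/-- The Lie algebra with basis `X`, `Y`, `δ_n` (`n ≥ 1`): the triple `(x, y, d)` stands for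
`x X + y Y + ∑ n, d n • δ_{n+1}`. -/
@[ext]
structure LieH1 : Type where
  /-- the coefficient of `X` -/
  x : ℂ
  /-- the coefficient of `Y` -/
  y : ℂ
  /-- the coefficients of the `δ_{n+1}` -/
  d : ℕ →₀ ℂ

namespace LieH1

/-- Coordinates. -/
def equiv : LieH1 ≃ ℂ × ℂ × (ℕ →₀ ℂ) where
  toFun a := (a.x, a.y, a.d)
  invFun a := ⟨a.1, a.2.1, a.2.2⟩

instance : AddCommGroup LieH1 := equiv.addCommGroup

instance : Module ℂ LieH1 := equiv.module ℂ

theorem mk_add (x y x' y' : ℂ) (d d' : ℕ →₀ ℂ) :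
    (⟨x, y, d⟩ + ⟨x', y', d'⟩ : LieH1) = ⟨x + x', y + y', d + d'⟩ := rfl

theorem mk_zero : (0 : LieH1) = ⟨0, 0, 0⟩ := rfl

theorem mk_smul (c x y : ℂ) (d : ℕ →₀ ℂ) :
    (c • ⟨x, y, d⟩ : LieH1) = ⟨c * x, c * y, c • d⟩ := rfl

/-- The shift `δ_n ↦ δ_{n+1}`. -/
def shift : (ℕ →₀ ℂ) →ₗ[ℂ] (ℕ →₀ ℂ) :=
  Finsupp.lsum ℂ fun n ↦ Finsupp.lsingle (n + 1)

/-- The grading `δ_n ↦ n δ_n`. -/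
def grade : (ℕ →₀ ℂ) →ₗ[ℂ] (ℕ →₀ ℂ) :=
  Finsupp.lsum ℂ fun n ↦ ((n : ℂ) + 1) • Finsupp.lsingle n

theorem grade_shift (d : ℕ →₀ ℂ) : grade (shift d) = shift (grade d) + shift d := by
  have : grade ∘ₗ shift = shift ∘ₗ grade + shift := by
    refine Finsupp.lhom_ext fun n c ↦ ?_
    simp only [LinearMap.comp_apply, LinearMap.add_apply, shift, grade, Finsupp.lsum_single,
      Finsupp.lsingle_apply, LinearMap.smul_apply, map_smul]
    push_cast
    module
  exact LinearMap.congr_fun this d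

/-- `[Y, X] = X`, `[Y, δ_n] = n δ_n`, `[X, δ_n] = δ_{n+1}`, `[δ_k, δ_l] = 0`. -/
instance : Bracket LieH1 LieH1 where
  bracket a b := ⟨a.y * b.x - b.y * a.x, 0,
    (a.y • grade b.d - b.y • grade a.d) + (a.x • shift b.d - b.x • shift a.d)⟩

theorem mk_bracket (x y x' y' : ℂ) (d d' : ℕ →₀ ℂ) :
    ⁅(⟨x, y, d⟩ : LieH1), (⟨x', y', d'⟩ : LieH1)⁆ = ⟨y * x' - y' * x, 0,
      (y • grade d' - y' • grade d) + (x • shift d' - x' • shift d)⟩ := rfl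

instance : LieRing LieH1 where
  add_lie := by
    rintro ⟨x, y, d⟩ ⟨x', y', d'⟩ ⟨x'', y'', d''⟩
    simp only [mk_bracket, mk_add, map_add]
    congr 1
    · ring
    · ring
    · module
  lie_add := by
    rintro ⟨x, y, d⟩ ⟨x', y', d'⟩ ⟨x'', y'', d''⟩
    simp only [mk_bracket, mk_add, map_add]
    congr 1
    · ring
    · ring
    · module
  lie_self := by
    rintro ⟨x, y, d⟩
    simp only [mk_bracket, sub_self, add_zero, mk_zero]
  leibniz_lie := by
    rintro ⟨x, y, d⟩ ⟨x', y', d'⟩ ⟨x'', y'', d''⟩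
    simp only [mk_bracket, mk_add, map_add, map_sub, map_smul, grade_shift]
    congr 1
    · ring
    · ring
    · module

instance : LieAlgebra ℂ LieH1 where
  lie_smul := by
    rintro c ⟨x, y, d⟩ ⟨x', y', d'⟩
    simp only [mk_bracket, mk_smul, map_smul]
    congr 1
    · ring
    · ring
    · module

end LieH1

/-- The Hopf algebra `ℋ₁`: as an algebra, the universal enveloping algebra of `LieH1`. -/
abbrev H1 : Type := UniversalEnvelopingAlgebra ℂ LieH1

namespace H1

attribute [local instance 100] LieRing.ofAssociativeRing LieAlgebra.ofAssociativeAlgebra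

/-- The generator `X`. -/
def X : H1 := UniversalEnvelopingAlgebra.ι ℂ (⟨1, 0, 0⟩ : LieH1)

/-- The generator `Y`. -/
def Y : H1 := UniversalEnvelopingAlgebra.ι ℂ (⟨0, 1, 0⟩ : LieH1)

/-- The generators: `delta n` is `δ_{n+1}`. -/
def delta (n : ℕ) : H1 :=
  UniversalEnvelopingAlgebra.ι ℂ (⟨0, 0, Finsupp.single n 1⟩ : LieH1)

theorem ι_bracket (a b : LieH1) : UniversalEnvelopingAlgebra.ι ℂ a * UniversalEnvelopingAlgebra.ι ℂ b -
    UniversalEnvelopingAlgebra.ι ℂ b * UniversalEnvelopingAlgebra.ι ℂ a =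
      UniversalEnvelopingAlgebra.ι ℂ ⁅a, b⁆ := by
  rw [LieHom.map_lie, LieRing.of_associative_ring_bracket]

theorem Y_X : Y * X - X * Y = X := by
  rw [X, Y, ι_bracket, LieH1.mk_bracket]
  simp

theorem X_delta (n : ℕ) : X * delta n - delta n * X = delta (n + 1) := by
  rw [X, delta, ι_bracket, LieH1.mk_bracket, delta]
  simp [LieH1.shift]

theorem Y_delta (n : ℕ) : Y * delta n - delta n * Y = ((n : ℂ) + 1) • delta n := by
  rw [Y, delta, ι_bracket, LieH1.mk_bracket]
  refine Eq.trans ?_ ((UniversalEnvelopingAlgebra.ι ℂ : LieH1 →ₗ⁅ℂ⁆ H1).map_smul'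
    ((n : ℂ) + 1) ⟨0, 0, Finsupp.single n 1⟩)
  rw [LieH1.mk_smul]
  simp [LieH1.grade]

theorem delta_comm (m n : ℕ) : delta m * delta n = delta n * delta m := by
  rw [← sub_eq_zero, delta, delta, ι_bracket, LieH1.mk_bracket]
  simp only [mul_zero, sub_self, zero_smul, add_zero, ← LieH1.mk_zero, map_zero]

section lift

variable {A : Type*} [Ring A] [Algebra ℂ A]

/-- The iterated commutators `[x, [x, … [x, d]]]`. -/
def iter (x d : A) : ℕ → A
  | 0 => d
  | n + 1 => x * iter x d n - iter x d n * x

theorem iter_grade {x y d : A} (hyx : y * x - x * y = x) (hyd : y * d - d * y = d) (n : ℕ) :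
    y * iter x d n - iter x d n * y = ((n : ℂ) + 1) • iter x d n := by
  induction n with
  | zero => simpa [iter] using hyd
  | succ n ih =>
    set e := iter x d n
    have h1 : y * x = x * y + x := by rw [← sub_eq_iff_eq_add']; exact hyx
    have h2 : y * e = e * y + ((n : ℂ) + 1) • e := by
      rw [← sub_eq_iff_eq_add']; exact ih
    change y * (x * e - e * x) - (x * e - e * x) * y = _ • (x * e - e * x)
    have h3 : y * (x * e) = x * e * y + ((n : ℂ) + 1) • (x * e) + x * e := by
      rw [← mul_assoc, h1, add_mul, mul_assoc, h2, mul_add, mul_smul_comm, mul_assoc]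
    have h4 : y * (e * x) = e * x * y + e * x + ((n : ℂ) + 1) • (e * x) := by
      rw [← mul_assoc, h2, add_mul, mul_assoc, h1, mul_add, smul_mul_assoc, mul_assoc]
    rw [mul_sub, h3, h4, sub_mul]
    push_cast
    module

/-- The homomorphism of Lie algebras with given values on `X`, `Y` and `δ_1`. -/
def liftLie (x y d : A) (hyx : y * x - x * y = x) (hyd : y * d - d * y = d)
    (hdd : ∀ m n, iter x d m * iter x d n = iter x d n * iter x d m) : LieH1 →ₗ⁅ℂ⁆ A where
  toFun a := a.x • x + a.y • y + Finsupp.linearCombination ℂ (iter x d) a.d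
  map_add' := by
    rintro ⟨a, b, c⟩ ⟨a', b', c'⟩
    simp only [LieH1.mk_add, map_add]
    module
  map_smul' := by
    rintro r ⟨a, b, c⟩
    change (r * a) • x + (r * b) • y + Finsupp.linearCombination ℂ (iter x d) (r • c) = r • _
    rw [map_smul]
    module
  map_lie' := by
    have hs (c : ℕ →₀ ℂ) : Finsupp.linearCombination ℂ (iter x d) (LieH1.shift c) =
        x * Finsupp.linearCombination ℂ (iter x d) c -
          Finsupp.linearCombination ℂ (iter x d) c * x := by
      induction c using Finsupp.induction_linear with
      | zero => simp
      | add f g hf hg => rw [map_add, map_add, map_add, hf, hg, mul_add, add_mul]; abel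
      | single n r =>
        simp [LieH1.shift, Finsupp.linearCombination_single, iter, smul_sub]
    have hg (c : ℕ →₀ ℂ) : Finsupp.linearCombination ℂ (iter x d) (LieH1.grade c) =
        y * Finsupp.linearCombination ℂ (iter x d) c -
          Finsupp.linearCombination ℂ (iter x d) c * y := by
      induction c using Finsupp.induction_linear with
      | zero => simp
      | add f g hf hg => rw [map_add, map_add, map_add, hf, hg, mul_add, add_mul]; abel
      | single n r =>
        simp only [LieH1.grade, Finsupp.lsum_single, LinearMap.smul_apply, Finsupp.lsingle_apply,
          map_smul, Finsupp.linearCombination_single, mul_smul_comm, smul_mul_assoc, ← smul_sub,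
          iter_grade hyx hyd]
        exact smul_comm _ _ _
    have hc (c c' : ℕ →₀ ℂ) : Finsupp.linearCombination ℂ (iter x d) c *
        Finsupp.linearCombination ℂ (iter x d) c' = Finsupp.linearCombination ℂ (iter x d) c' *
        Finsupp.linearCombination ℂ (iter x d) c := by
      induction c using Finsupp.induction_linear with
      | zero => simp
      | add f g hf hg => rw [map_add, add_mul, mul_add, hf, hg]
      | single n r =>
        induction c' using Finsupp.induction_linear with
        | zero => simp
        | add f g hf hg => rw [map_add, add_mul, mul_add, hf, hg]
        | single m s =>
          simp only [Finsupp.linearCombination_single, smul_mul_smul_comm, hdd n m, mul_comm r s]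
    rintro ⟨a, b, c⟩ ⟨a', b', c'⟩
    rw [LieRing.of_associative_ring_bracket]
    change (b * a' - b' * a) • x + (0 : ℂ) • y + Finsupp.linearCombination ℂ (iter x d)
      ((b • LieH1.grade c' - b' • LieH1.grade c) + (a • LieH1.shift c' - a' • LieH1.shift c)) =
      (a • x + b • y + _) * (a' • x + b' • y + _) - (a' • x + b' • y + _) * (a • x + b • y + _)
    simp only [map_add, map_sub, map_smul, hs, hg]
    have := hc c c'
    generalize Finsupp.linearCombination ℂ (iter x d) c = C at *
    generalize Finsupp.linearCombination ℂ (iter x d) c' = C' at *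
    simp only [add_mul, mul_add, smul_mul_assoc, mul_smul_comm, this]
    have h1 : y * x = x * y + x := by rw [← sub_eq_iff_eq_add']; exact hyx
    rw [h1]
    module

/-- The homomorphism of algebras on `ℋ₁` with given values on `X`, `Y` and `δ_1`. -/
def lift (x y d : A) (hyx : y * x - x * y = x) (hyd : y * d - d * y = d)
    (hdd : ∀ m n, iter x d m * iter x d n = iter x d n * iter x d m) : H1 →ₐ[ℂ] A :=
  UniversalEnvelopingAlgebra.lift ℂ (liftLie x y d hyx hyd hdd)

variable {x y d : A} {hyx : y * x - x * y = x} {hyd : y * d - d * y = d}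
    {hdd : ∀ m n, iter x d m * iter x d n = iter x d n * iter x d m}

theorem lift_X : lift x y d hyx hyd hdd X = x := by
  rw [lift, X, UniversalEnvelopingAlgebra.lift_ι_apply]
  change (1 : ℂ) • x + (0 : ℂ) • y + Finsupp.linearCombination ℂ (iter x d) 0 = x
  simp

theorem lift_Y : lift x y d hyx hyd hdd Y = y := by
  rw [lift, Y, UniversalEnvelopingAlgebra.lift_ι_apply]
  change (0 : ℂ) • x + (1 : ℂ) • y + Finsupp.linearCombination ℂ (iter x d) 0 = y
  simp

theorem lift_delta (n : ℕ) : lift x y d hyx hyd hdd (delta n) = iter x d n := by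
  rw [lift, delta, UniversalEnvelopingAlgebra.lift_ι_apply]
  change (0 : ℂ) • x + (0 : ℂ) • y + Finsupp.linearCombination ℂ (iter x d) _ = _
  simp

theorem hom_ext {φ ψ : H1 →ₐ[ℂ] A} (hX : φ X = ψ X) (hY : φ Y = ψ Y)
    (hd : φ (delta 0) = ψ (delta 0)) : φ = ψ := by
  have hdn (n : ℕ) : φ (delta n) = ψ (delta n) := by
    induction n with
    | zero => exact hd
    | succ n ih => rw [← X_delta]; simp only [map_sub, map_mul, hX, ih]
  let i : LieH1 →ₗ[ℂ] H1 := (UniversalEnvelopingAlgebra.ι ℂ : LieH1 →ₗ⁅ℂ⁆ H1)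
  let e : (ℕ →₀ ℂ) →ₗ[ℂ] LieH1 :=
    { toFun := fun c ↦ ⟨0, 0, c⟩
      map_add' := fun c c' ↦ by simp [LieH1.mk_add]
      map_smul' := fun r c ↦ by simp [LieH1.mk_smul] }
  have hl : φ.toLinearMap ∘ₗ i ∘ₗ e = ψ.toLinearMap ∘ₗ i ∘ₗ e := by
    refine Finsupp.lhom_ext' fun n ↦ LinearMap.ext_ring ?_
    exact hdn n
  refine UniversalEnvelopingAlgebra.hom_ext ℂ (LieHom.ext fun a ↦ ?_)
  obtain ⟨a, b, c⟩ := a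
  change φ (i ⟨a, b, c⟩) = ψ (i ⟨a, b, c⟩)
  have : (⟨a, b, c⟩ : LieH1) = a • ⟨1, 0, 0⟩ + b • ⟨0, 1, 0⟩ + e c := by
    change _ = a • (⟨1, 0, 0⟩ : LieH1) + b • ⟨0, 1, 0⟩ + ⟨0, 0, c⟩
    simp [LieH1.mk_smul, LieH1.mk_add]
  rw [this]
  simp only [map_add, map_smul]
  have h3 : φ (i (e c)) = ψ (i (e c)) := LinearMap.congr_fun hl c
  have h1 : φ (i ⟨1, 0, 0⟩) = ψ (i ⟨1, 0, 0⟩) := hX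
  have h2 : φ (i ⟨0, 1, 0⟩) = ψ (i ⟨0, 1, 0⟩) := hY
  rw [h1, h2, h3]

theorem iter_comm {x d : A} (S : Set A) (hS : ∀ a ∈ S, ∀ b ∈ S, a * b = b * a)
    (hd : d ∈ Algebra.adjoin ℂ S) (hx : ∀ s ∈ S, x * s - s * x ∈ Algebra.adjoin ℂ S) (m n : ℕ) :
    iter x d m * iter x d n = iter x d n * iter x d m := by
  have hx' : ∀ c ∈ Algebra.adjoin ℂ S, x * c - c * x ∈ Algebra.adjoin ℂ S := by
    intro c hc
    induction hc using Algebra.adjoin_induction with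
    | mem s hs => exact hx s hs
    | algebraMap r => rw [Algebra.commutes, sub_self]; exact zero_mem _
    | add a b _ _ ha hb =>
      rw [show x * (a + b) - (a + b) * x = (x * a - a * x) + (x * b - b * x) by noncomm_ring]
      exact add_mem ha hb
    | mul a b ha' hb' ha hb =>
      rw [show x * (a * b) - a * b * x = (x * a - a * x) * b + a * (x * b - b * x) by
        noncomm_ring]
      exact add_mem (mul_mem ha hb') (mul_mem ha' hb)
  have hmem (n : ℕ) : iter x d n ∈ Algebra.adjoin ℂ S := by
    induction n with
    | zero => exact hd
    | succ n ih => exact hx' _ ih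
  have := Algebra.isMulCommutative_adjoin ℂ hS
  exact congrArg Subtype.val (mul_comm' (⟨_, hmem m⟩ : Algebra.adjoin ℂ S) ⟨_, hmem n⟩)

end lift

/-- The modular character `δ`: `δ(X) = 0`, `δ(Y) = 1`, `δ(δ_n) = 0`. -/
def modularCharacter : H1 →ₐ[ℂ] ℂ :=
  lift 0 1 0 (by simp) (by simp) fun _ _ ↦ mul_comm _ _

/-- The counit: `ε(X) = ε(Y) = ε(δ_n) = 0`. -/
def counitHom : H1 →ₐ[ℂ] ℂ :=
  lift 0 0 0 (by simp) (by simp) fun _ _ ↦ mul_comm _ _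

theorem YX' : Y * X = X * Y + X := by rw [← sub_eq_iff_eq_add']; exact Y_X

theorem YD' (n : ℕ) : Y * delta n = delta n * Y + ((n : ℂ) + 1) • delta n := by
  rw [← sub_eq_iff_eq_add']; exact Y_delta n

theorem YD0 : Y * delta 0 = delta 0 * Y + delta 0 := by
  rw [YD']; simp

theorem XD' (n : ℕ) : X * delta n = delta n * X + delta (n + 1) := by
  rw [← sub_eq_iff_eq_add']; exact X_delta n

/-- The coproduct: `Δ X = X ⊗ 1 + 1 ⊗ X + δ_1 ⊗ Y`, `Δ Y = Y ⊗ 1 + 1 ⊗ Y`,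
`Δ δ_1 = δ_1 ⊗ 1 + 1 ⊗ δ_1`. -/
def comulHom : H1 →ₐ[ℂ] H1 ⊗[ℂ] H1 :=
  lift (X ⊗ₜ 1 + 1 ⊗ₜ X + delta 0 ⊗ₜ Y) (Y ⊗ₜ 1 + 1 ⊗ₜ Y) (delta 0 ⊗ₜ 1 + 1 ⊗ₜ delta 0)
    (by
      simp only [add_mul, mul_add, Algebra.TensorProduct.tmul_mul_tmul, one_mul, mul_one, YX',
        YD0, TensorProduct.add_tmul, TensorProduct.tmul_add]
      abel)
    (by
      simp only [add_mul, mul_add, Algebra.TensorProduct.tmul_mul_tmul, one_mul, mul_one,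
        YD0, TensorProduct.add_tmul, TensorProduct.tmul_add]
      abel)
    (iter_comm (Set.range (fun n ↦ delta n ⊗ₜ 1) ∪ Set.range (fun n ↦ 1 ⊗ₜ delta n))
      (by
        rintro _ (⟨m, rfl⟩ | ⟨m, rfl⟩) _ (⟨n, rfl⟩ | ⟨n, rfl⟩) <;>
          simp [Algebra.TensorProduct.tmul_mul_tmul, delta_comm m n])
      (add_mem (Algebra.subset_adjoin (Or.inl ⟨0, rfl⟩))
        (Algebra.subset_adjoin (Or.inr ⟨0, rfl⟩)))
      (by
        rintro _ (⟨n, rfl⟩ | ⟨n, rfl⟩)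
        · have : (X ⊗ₜ 1 + 1 ⊗ₜ X + delta 0 ⊗ₜ Y) * (delta n ⊗ₜ[ℂ] (1 : H1)) -
              (delta n ⊗ₜ[ℂ] (1 : H1)) * (X ⊗ₜ 1 + 1 ⊗ₜ X + delta 0 ⊗ₜ Y) =
              delta (n + 1) ⊗ₜ 1 := by
            simp only [add_mul, mul_add, Algebra.TensorProduct.tmul_mul_tmul, one_mul, mul_one,
              XD', TensorProduct.add_tmul, delta_comm n 0]
            abel
          simp only [this]
          exact Algebra.subset_adjoin (Or.inl ⟨n + 1, rfl⟩)
        · have : (X ⊗ₜ 1 + 1 ⊗ₜ X + delta 0 ⊗ₜ Y) * ((1 : H1) ⊗ₜ[ℂ] delta n) -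
              ((1 : H1) ⊗ₜ[ℂ] delta n) * (X ⊗ₜ 1 + 1 ⊗ₜ X + delta 0 ⊗ₜ Y) =
              1 ⊗ₜ delta (n + 1) + ((n : ℂ) + 1) • ((delta 0 ⊗ₜ 1) * (1 ⊗ₜ delta n)) := by
            simp only [add_mul, mul_add, Algebra.TensorProduct.tmul_mul_tmul, one_mul, mul_one,
              XD', YD', TensorProduct.tmul_add, TensorProduct.tmul_smul]
            abel
          simp only [this]
          refine add_mem (Algebra.subset_adjoin (Or.inr ⟨n + 1, rfl⟩))
            (Subalgebra.smul_mem _ ?_ _)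
          refine mul_mem ?_ ?_
          · exact Algebra.subset_adjoin (Or.inl ⟨0, rfl⟩)
          · exact Algebra.subset_adjoin (Or.inr ⟨n, rfl⟩)))

theorem comulHom_X : comulHom X = X ⊗ₜ 1 + 1 ⊗ₜ X + delta 0 ⊗ₜ Y := lift_X

theorem comulHom_Y : comulHom Y = Y ⊗ₜ 1 + 1 ⊗ₜ Y := lift_Y

theorem comulHom_delta : comulHom (delta 0) = delta 0 ⊗ₜ 1 + 1 ⊗ₜ delta 0 := lift_delta 0

theorem counitHom_X : counitHom X = 0 := lift_X

theorem counitHom_Y : counitHom Y = 0 := lift_Y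

theorem counitHom_delta : counitHom (delta 0) = 0 := lift_delta 0

instance : Bialgebra ℂ H1 :=
  Bialgebra.ofAlgHom comulHom counitHom
    (by
      apply hom_ext <;>
        simp [comulHom_X, comulHom_Y, comulHom_delta, TensorProduct.add_tmul,
          TensorProduct.tmul_add, Algebra.TensorProduct.one_def]
      all_goals abel)
    (by
      apply hom_ext <;>
        simp [comulHom_X, comulHom_Y, comulHom_delta, counitHom_X, counitHom_Y, counitHom_delta])
    (by
      apply hom_ext <;>
        simp [comulHom_X, comulHom_Y, comulHom_delta, counitHom_X, counitHom_Y, counitHom_delta])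

/-- The antipode, as a homomorphism to the opposite algebra: `S(X) = -X + δ_1 Y`,
`S(Y) = -Y`, `S(δ_1) = -δ_1`. -/
def antipodeHom : H1 →ₐ[ℂ] H1ᵐᵒᵖ :=
  lift (.op (-X + delta 0 * Y)) (.op (-Y)) (.op (-delta 0))
    (by
      rw [← MulOpposite.op_mul, ← MulOpposite.op_mul, ← MulOpposite.op_sub]
      congr 1
      have h : Y * (delta 0 * Y) = delta 0 * Y * Y + delta 0 * Y := by
        rw [← mul_assoc, YD0, add_mul]
      have : -Y * (-X + delta 0 * Y) = Y * X - Y * (delta 0 * Y) := by noncomm_ring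
      rw [this, h, YX']
      noncomm_ring)
    (by
      rw [← MulOpposite.op_mul, ← MulOpposite.op_mul, ← MulOpposite.op_sub]
      congr 1
      rw [neg_mul_neg, neg_mul_neg, YD0]
      abel)
    (iter_comm (Set.range fun n ↦ .op (delta n))
      (by
        rintro _ ⟨m, rfl⟩ _ ⟨n, rfl⟩
        simp only [← MulOpposite.op_mul, delta_comm m n])
      (by
        rw [MulOpposite.op_neg]
        exact neg_mem (Algebra.subset_adjoin ⟨0, rfl⟩))
      (by
        rintro _ ⟨n, rfl⟩
        have : delta n * (-X + delta 0 * Y) - (-X + delta 0 * Y) * delta n =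
            delta (n + 1) - ((n : ℂ) + 1) • (delta n * delta 0) := by
          have h1 : (-X + delta 0 * Y) * delta n = -(X * delta n) + delta 0 * (Y * delta n) := by
            noncomm_ring
          rw [h1, XD', YD', mul_add, mul_add, mul_smul_comm, delta_comm n 0, ← mul_assoc,
            ← mul_assoc, delta_comm n 0, mul_neg]
          abel
        simp only [← MulOpposite.op_mul, ← MulOpposite.op_sub, this]
        rw [MulOpposite.op_sub, MulOpposite.op_smul, MulOpposite.op_mul]
        refine sub_mem (Algebra.subset_adjoin ⟨n + 1, rfl⟩) (Subalgebra.smul_mem _ ?_ _)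
        refine mul_mem ?_ ?_
        · exact Algebra.subset_adjoin ⟨0, rfl⟩
        · exact Algebra.subset_adjoin ⟨n, rfl⟩))

theorem map_iter {A B : Type*} [Ring A] [Algebra ℂ A] [Ring B] [Algebra ℂ B] (φ : A →ₐ[ℂ] B)
    (x d : A) (n : ℕ) : φ (iter x d n) = iter (φ x) (φ d) n := by
  induction n with
  | zero => rfl
  | succ n ih => simp only [iter, map_sub, map_mul, ih]

theorem iter_X_delta (n : ℕ) : iter X (delta 0) n = delta n := by
  induction n with
  | zero => rfl
  | succ n ih => rw [iter, ih, X_delta]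

/-- A subalgebra that contains `X`, `Y` and `δ_1` is everything. -/
theorem mem_of_generators (B : Subalgebra ℂ H1) (hX : X ∈ B) (hY : Y ∈ B) (hd : delta 0 ∈ B)
    (h : H1) : h ∈ B := by
  let φ : H1 →ₐ[ℂ] B := lift ⟨X, hX⟩ ⟨Y, hY⟩ ⟨delta 0, hd⟩ (Subtype.ext Y_X)
    (Subtype.ext (by simpa using Y_delta 0)) fun m n ↦ Subtype.ext (by
      change B.val (iter _ _ m) * B.val (iter _ _ n) = B.val (iter _ _ n) * B.val (iter _ _ m)
      rw [map_iter, map_iter]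
      change iter X (delta 0) m * iter X (delta 0) n = iter X (delta 0) n * iter X (delta 0) m
      rw [iter_X_delta, iter_X_delta, delta_comm])
  have : B.val.comp φ = AlgHom.id ℂ H1 := by
    apply hom_ext
    · exact congrArg B.val lift_X
    · exact congrArg B.val lift_Y
    · exact congrArg B.val (lift_delta 0)
  rw [← AlgHom.id_apply (R := ℂ) h, ← this]
  exact (φ h).2

/-- The antipode of `ℋ₁`. -/
def antipodeLin : H1 →ₗ[ℂ] H1 :=
  (MulOpposite.opLinearEquiv ℂ).symm.toLinearMap ∘ₗ antipodeHom.toLinearMap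

theorem antipodeLin_mul (a b : H1) : antipodeLin (a * b) = antipodeLin b * antipodeLin a := by
  simp [antipodeLin]

theorem antipodeLin_one : antipodeLin 1 = 1 := by
  simp [antipodeLin]

theorem antipodeLin_X : antipodeLin X = -X + delta 0 * Y :=
  congrArg MulOpposite.unop lift_X

theorem antipodeLin_Y : antipodeLin Y = -Y :=
  congrArg MulOpposite.unop lift_Y

theorem antipodeLin_delta : antipodeLin (delta 0) = -delta 0 :=
  congrArg MulOpposite.unop (lift_delta 0)

/-- `a ⊗ b ↦ S(a) b`. -/
def leftConv : H1 ⊗[ℂ] H1 →ₗ[ℂ] H1 := LinearMap.mul' ℂ H1 ∘ₗ antipodeLin.rTensor H1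

/-- `a ⊗ b ↦ a S(b)`. -/
def rightConv : H1 ⊗[ℂ] H1 →ₗ[ℂ] H1 := LinearMap.mul' ℂ H1 ∘ₗ antipodeLin.lTensor H1

theorem leftConv_tmul (a b : H1) : leftConv (a ⊗ₜ b) = antipodeLin a * b := rfl

theorem rightConv_tmul (a b : H1) : rightConv (a ⊗ₜ b) = a * antipodeLin b := rfl

theorem leftConv_one : leftConv 1 = 1 := by
  rw [Algebra.TensorProduct.one_def, leftConv_tmul, antipodeLin_one, mul_one]

theorem leftConv_mul (t : H1 ⊗[ℂ] H1) (b c : H1) :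
    leftConv (t * (b ⊗ₜ c)) = antipodeLin b * leftConv t * c := by
  induction t using TensorProduct.induction_on with
  | zero => simp
  | add x y hx hy => rw [add_mul, map_add, hx, hy, map_add, mul_add, add_mul]
  | tmul x y =>
    rw [Algebra.TensorProduct.tmul_mul_tmul, leftConv_tmul, leftConv_tmul, antipodeLin_mul]
    noncomm_ring

theorem rightConv_one : rightConv 1 = 1 := by
  rw [Algebra.TensorProduct.one_def, rightConv_tmul, antipodeLin_one, mul_one]

theorem rightConv_mul (t : H1 ⊗[ℂ] H1) (b c : H1) :
    rightConv ((b ⊗ₜ c) * t) = b * rightConv t * antipodeLin c := by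
  induction t using TensorProduct.induction_on with
  | zero => simp
  | add x y hx hy => rw [mul_add, map_add, hx, hy, map_add, mul_add, add_mul]
  | tmul x y =>
    rw [Algebra.TensorProduct.tmul_mul_tmul, rightConv_tmul, rightConv_tmul, antipodeLin_mul]
    noncomm_ring

theorem leftConv_comul (h : H1) : leftConv (comulHom h) = algebraMap ℂ H1 (counitHom h) := by
  let B : Subalgebra ℂ H1 :=
    { carrier := {h | leftConv (comulHom h) = algebraMap ℂ H1 (counitHom h)}
      algebraMap_mem' := fun r ↦ by
        simp [Algebra.algebraMap_eq_smul_one, leftConv_one]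
      add_mem' := fun {a b} (ha : _ = _) (hb : _ = _) ↦ by
        simp only [Set.mem_ofPred_eq, map_add, ha, hb]
      mul_mem' := fun {a b} (ha : _ = _) (hb : _ = _) ↦ by
        have key (u : H1 ⊗[ℂ] H1) :
            leftConv (comulHom a * u) = algebraMap ℂ H1 (counitHom a) * leftConv u := by
          induction u using TensorProduct.induction_on with
          | zero => simp
          | add x y hx hy => rw [mul_add, map_add, hx, hy, map_add, mul_add]
          | tmul x y =>
            rw [leftConv_mul, ha, leftConv_tmul, ← Algebra.commutes, mul_assoc]
        simp only [Set.mem_ofPred_eq, map_mul, key, hb] }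
  refine mem_of_generators B ?_ ?_ ?_ h
  · change leftConv (comulHom X) = algebraMap ℂ H1 (counitHom X)
    rw [comulHom_X, counitHom_X, map_add, map_add, leftConv_tmul, leftConv_tmul, leftConv_tmul,
      antipodeLin_X, antipodeLin_one, antipodeLin_delta]
    simp
  · change leftConv (comulHom Y) = algebraMap ℂ H1 (counitHom Y)
    rw [comulHom_Y, counitHom_Y, map_add, leftConv_tmul, leftConv_tmul,
      antipodeLin_Y, antipodeLin_one]
    simp
  · change leftConv (comulHom (delta 0)) = algebraMap ℂ H1 (counitHom (delta 0))
    rw [comulHom_delta, counitHom_delta, map_add, leftConv_tmul, leftConv_tmul,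
      antipodeLin_delta, antipodeLin_one]
    simp

theorem rightConv_comul (h : H1) : rightConv (comulHom h) = algebraMap ℂ H1 (counitHom h) := by
  let B : Subalgebra ℂ H1 :=
    { carrier := {h | rightConv (comulHom h) = algebraMap ℂ H1 (counitHom h)}
      algebraMap_mem' := fun r ↦ by
        simp [Algebra.algebraMap_eq_smul_one, rightConv_one]
      add_mem' := fun {a b} (ha : _ = _) (hb : _ = _) ↦ by
        simp only [Set.mem_ofPred_eq, map_add, ha, hb]
      mul_mem' := fun {a b} (ha : _ = _) (hb : _ = _) ↦ by
        have key (u : H1 ⊗[ℂ] H1) :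
            rightConv (u * comulHom b) = rightConv u * algebraMap ℂ H1 (counitHom b) := by
          induction u using TensorProduct.induction_on with
          | zero => simp
          | add x y hx hy => rw [add_mul, map_add, hx, hy, map_add, add_mul]
          | tmul x y =>
            rw [rightConv_mul, hb, rightConv_tmul, mul_assoc, mul_assoc, Algebra.commutes]
        simp only [Set.mem_ofPred_eq, map_mul, key, ha] }
  refine mem_of_generators B ?_ ?_ ?_ h
  · change rightConv (comulHom X) = algebraMap ℂ H1 (counitHom X)
    rw [comulHom_X, counitHom_X, map_add, map_add, rightConv_tmul, rightConv_tmul, rightConv_tmul,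
      antipodeLin_X, antipodeLin_one, antipodeLin_Y]
    simp
  · change rightConv (comulHom Y) = algebraMap ℂ H1 (counitHom Y)
    rw [comulHom_Y, counitHom_Y, map_add, rightConv_tmul, rightConv_tmul,
      antipodeLin_Y, antipodeLin_one]
    simp
  · change rightConv (comulHom (delta 0)) = algebraMap ℂ H1 (counitHom (delta 0))
    rw [comulHom_delta, counitHom_delta, map_add, rightConv_tmul, rightConv_tmul,
      antipodeLin_delta, antipodeLin_one]
    simp

instance : HopfAlgebra ℂ H1 where
  antipode := antipodeLin
  mul_antipode_rTensor_comul := LinearMap.ext leftConv_comul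
  mul_antipode_lTensor_comul := LinearMap.ext rightConv_comul

end H1

/-! ### The standard action of `ℋ₁` on `𝒜` -/

theorem mulLeft_comm (f g : FormAlgebra) :
    LinearMap.mulLeft ℂ f * LinearMap.mulLeft ℂ g =
      LinearMap.mulLeft ℂ g * LinearMap.mulLeft ℂ f := by
  ext x
  simp only [Module.End.mul_apply, LinearMap.mulLeft_apply]
  ring

theorem iter_mulLeft (n : ℕ) :
    H1.iter (fun _ ↦ opX : GL(2, ℚ)⁺ → Module.End ℂ FormAlgebra)
      (fun γ ↦ LinearMap.mulLeft ℂ (muForm γ⁻¹)) n =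
        fun γ ↦ LinearMap.mulLeft ℂ (muIter γ⁻¹ n) := by
  induction n with
  | zero => rfl
  | succ n ih =>
    rw [H1.iter, ih]
    funext γ
    refine LinearMap.ext fun x ↦ ?_
    change opX (muIter γ⁻¹ n * x) - muIter γ⁻¹ n * opX x = muIter γ⁻¹ (n + 1) * x
    rw [opX_mul, opX_muIter]
    ring

/-- The standard action of `ℋ₁` on `𝒜`: `X` is the Ramanujan connection, `Y` is half the weight and
`δ_n (f U_γ^*) = X^{n-1} (μ_γ) f U_γ^*`, where `U_γ^* = U_{γ⁻¹}`. -/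
def standardAction : H1 →ₐ[ℂ] Module.End ℂ CrossedProduct :=
  componentwise.comp (H1.lift (fun _ ↦ opX) (fun _ ↦ opY)
    (fun γ ↦ LinearMap.mulLeft ℂ (muForm γ⁻¹))
    (by
      funext γ
      refine LinearMap.ext fun x ↦ ?_
      change opY (opX x) - opX (opY x) = opX x
      rw [opY_opX, add_sub_cancel_left])
    (by
      funext γ
      refine LinearMap.ext fun x ↦ ?_
      change opY (muForm γ⁻¹ * x) - muForm γ⁻¹ * opY x = muForm γ⁻¹ * x
      have h : opY (muForm γ⁻¹) = muForm γ⁻¹ := by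
        have := opY_muIter γ⁻¹ 0
        simpa [muIter] using this
      rw [opY_mul, h, add_sub_cancel_right])
    (by
      intro m n
      rw [iter_mulLeft, iter_mulLeft]
      funext γ
      exact mulLeft_comm _ _))

theorem standardAction_X (f : FormAlgebra) (γ : GL(2, ℚ)⁺) :
    standardAction H1.X (mono f γ) = mono (opX f) γ := by
  rw [standardAction, AlgHom.comp_apply, H1.lift_X, componentwise_mono]

theorem standardAction_Y (f : FormAlgebra) (γ : GL(2, ℚ)⁺) :
    standardAction H1.Y (mono f γ) = mono (opY f) γ := by
  rw [standardAction, AlgHom.comp_apply, H1.lift_Y, componentwise_mono]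

theorem standardAction_delta (n : ℕ) (f : FormAlgebra) (γ : GL(2, ℚ)⁺) :
    standardAction (H1.delta n) (mono f γ) = mono (muIter γ⁻¹ n * f) γ := by
  rw [standardAction, AlgHom.comp_apply, H1.lift_delta, iter_mulLeft, componentwise_mono]
  rfl

/-! ### The standard action is a Hopf action -/

theorem ramanujan_slash {k : ℤ} {g : ℍ → ℂ} (hg : MDiff g) (γ : GL(2, ℚ)⁺) :
    ramanujan k (slash k γ g) =
      slash (k + 2) γ (ramanujan k g) + mu γ * slash k γ (((k : ℂ) / 2) • g) := by
  have hm : mu γ = (6 : ℂ)⁻¹ • ((EisensteinSeries.E2 ∣[(2 : ℤ)] toGLReal γ) -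
      (fun z : ℍ ↦ ((12 : ℤ) : ℂ) * (2 * Real.pi * I)⁻¹ *
        (toGLReal γ 1 0 / denom (toGLReal γ) z)) - EisensteinSeries.E2) := by
    rw [mu_eq, logD_slash mdiff_discriminant ModularForm.discriminant_ne_zero, logD_discriminant]
  have hdet := toGLReal_val_det_pos γ
  have h' := toGLReal_det_pos γ
  have hσ (x) : UpperHalfPlane.σ (toGLReal γ) x = x := by
    simp only [UpperHalfPlane.σ, if_pos h', ContinuousAlgEquiv.refl_apply]
  have hf : slashFactor (k + 2) γ = ((toGLReal γ).val.det : ℂ)⁻¹ * slashFactor k γ := by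
    have hd : ((toGLReal γ).det.val : ℂ) ≠ 0 := ofReal_ne_zero.mpr h'.ne'
    rw [slashFactor, slashFactor, zpow_add₀ (sqrt_det_ne_zero γ),
      show 1 - (k + 2) = (1 - k) + (-1) + (-1) by ring, zpow_add₀ hd, zpow_add₀ hd, zpow_neg_one,
      ← Matrix.GeneralLinearGroup.val_det_apply]
    have : ((√((toGLReal γ).det.val) : ℝ) : ℂ) ^ (2 : ℤ) = ((toGLReal γ).det.val : ℂ) := by
      rw [zpow_ofNat, ← ofReal_pow, Real.sq_sqrt h'.le]
    rw [this]
    field_simp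
  simp only [ramanujan_eq]
  rw [slash_eq k γ g, Derivative.serreDerivative_smul _ _ _ (hg.slash k _), slash_eq, slash_eq, hf,
    ModularForm.smul_slash, hσ]
  ext z
  rw [Pi.smul_apply, Derivative.serreDerivative_apply,
    Derivative.normalizedDerivOfComplex_slash hg hdet, hm]
  have hz := denom_ne_zero (toGLReal γ) z
  have hd : ((toGLReal γ).val.det : ℂ) ≠ 0 := ofReal_ne_zero.mpr hdet.ne'
  simp only [Pi.add_apply, Pi.mul_apply, Pi.smul_apply, Pi.sub_apply, smul_eq_mul,
    ModularForm.slash_apply, hσ, Derivative.serreDerivative_apply,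
    Matrix.GeneralLinearGroup.val_det_apply, abs_of_pos hdet]
  rw [show k + 2 - 1 = (k - 1) + 2 by ring, show -(k + 2) = -k + -2 by ring,
    zpow_add₀ hd, zpow_add₀ hz, show (2 : ℤ) - 1 = 1 by norm_num, zpow_one, zpow_ofNat]
  push_cast
  field_simp
  ring

theorem opX_slashLin (γ : GL(2, ℚ)⁺) (g : FormAlgebra) :
    opX (slashLin γ g) = slashLin γ (opX g) + muForm γ * slashLin γ (opY g) := by
  induction g using form_induction with
  | h0 => simp
  | ha a b h1 h2 => simp only [map_add, h1, h2, mul_add]; abel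
  | hf k f =>
    rw [slashLin_form, opX_form, opX_form, slashLin_form, opY_form, ← map_smul, slashLin_form,
      muForm, form_mul_form]
    have e : 2 + k = k + 2 := by ring
    have m : IsModular (k + 2) (mu γ * slash k γ (((k : ℂ) / 2) • (f : ℍ → ℂ))) :=
      e ▸ (isModular_mu γ).mul ((f.2.smul _).slash γ)
    rw [form_congr e (g := ⟨_, m⟩) rfl, ← map_add]
    exact form_congr rfl (ramanujan_slash f.2.mdiff γ)

theorem opY_slashLin (γ : GL(2, ℚ)⁺) (g : FormAlgebra) :
    opY (slashLin γ g) = slashLin γ (opY g) := by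
  induction g using form_induction with
  | h0 => simp
  | ha a b h1 h2 => simp only [map_add, h1, h2]
  | hf k f => rw [slashLin_form, opY_form, opY_form, map_smul, slashLin_form]

theorem muForm_mul (α β : GL(2, ℚ)⁺) :
    muForm (α * β) = slashLin β (muForm α) + muForm β := by
  rw [muForm, muForm, muForm, slashLin_form, ← map_add]
  refine form_congr rfl ((mu_mul α β).trans ?_)
  have h : slashFactor 2 β = 1 := by
    have h' := toGLReal_det_pos β
    have hd : ((toGLReal β).det.val : ℂ) ≠ 0 := ofReal_ne_zero.mpr h'.ne'
    rw [slashFactor, zpow_ofNat, ← ofReal_pow, Real.sq_sqrt h'.le,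
      show (1 : ℤ) - 2 = -1 by norm_num, zpow_neg_one, mul_inv_cancel₀ hd]
  change _ = slash 2 β (mu α) + mu β
  rw [slash_eq, h, one_smul]

theorem mono_add (f g : FormAlgebra) (γ : GL(2, ℚ)⁺) : mono (f + g) γ = mono f γ + mono g γ :=
  map_add (monoLin γ) f g

theorem standardAction_X_mul_mono (f g : FormAlgebra) (α β : GL(2, ℚ)⁺) :
    standardAction H1.X (mono f α * mono g β) =
      standardAction H1.X (mono f α) * mono g β + mono f α * standardAction H1.X (mono g β) +
        standardAction (H1.delta 0) (mono f α) * standardAction H1.Y (mono g β) := by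
  simp only [mono_mul_mono, standardAction_X, standardAction_Y, standardAction_delta, ← mono_add]
  rw [opX_mul, opX_slashLin]
  congr 1
  change _ = _ + _ + muForm α⁻¹ * f * _
  ring

theorem standardAction_Y_mul_mono (f g : FormAlgebra) (α β : GL(2, ℚ)⁺) :
    standardAction H1.Y (mono f α * mono g β) =
      standardAction H1.Y (mono f α) * mono g β + mono f α * standardAction H1.Y (mono g β) := by
  simp only [mono_mul_mono, standardAction_Y, ← mono_add]
  rw [opY_mul, opY_slashLin]

theorem standardAction_delta_mul_mono (f g : FormAlgebra) (α β : GL(2, ℚ)⁺) :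
    standardAction (H1.delta 0) (mono f α * mono g β) =
      standardAction (H1.delta 0) (mono f α) * mono g β +
        mono f α * standardAction (H1.delta 0) (mono g β) := by
  simp only [mono_mul_mono, standardAction_delta, ← mono_add]
  congr 1
  change muForm (α * β)⁻¹ * _ = muForm α⁻¹ * f * _ + f * slashLin α⁻¹ (muForm β⁻¹ * g)
  rw [mul_inv_rev, muForm_mul, slashLin_map_mul]
  ring

/-! ### The cochain `τ₀` -/

/-- The integral `∫_z^w f(ζ) dζ` along the segment from `z` to `w`. -/
def lineIntegral (f : ℍ → ℂ) (z w : ℍ) : ℂ :=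
  ∫ t in (0 : ℝ)..1, f (ofComplex (z + t * (w - z))) * ((w : ℂ) - z)

theorem segment_im_pos (z w : ℍ) {t : ℝ} (ht : t ∈ Set.Icc (0 : ℝ) 1) :
    0 < ((z : ℂ) + t * (w - z)).im := by
  have hz : 0 < (z : ℂ).im := z.2
  have hw : 0 < (w : ℂ).im := w.2
  have h : ((z : ℂ) + t * (w - z)).im = (1 - t) * (z : ℂ).im + t * (w : ℂ).im := by
    simp; ring
  rw [h]
  rcases ht.1.eq_or_lt with rfl | h0
  · simpa using hz
  · have := mul_pos h0 hw
    have := mul_nonneg (sub_nonneg.mpr ht.2) hz.le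
    linarith

theorem intervalIntegrable_segment {f : ℍ → ℂ} (hf : MDiff f) (z w : ℍ) :
    IntervalIntegrable (fun t : ℝ ↦ f (ofComplex (z + t * (w - z))) * ((w : ℂ) - z))
      MeasureTheory.volume 0 1 := by
  refine ContinuousOn.intervalIntegrable ?_
  rw [Set.uIcc_of_le zero_le_one]
  refine ContinuousOn.mul ?_ continuousOn_const
  have h1 : ContinuousOn (f ∘ ofComplex) {z | 0 < z.im} :=
    (UpperHalfPlane.mdifferentiable_iff.mp hf).continuousOn
  exact h1.comp (by fun_prop) fun t ht ↦ segment_im_pos z w ht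

theorem lineIntegral_add {f g : ℍ → ℂ} (hf : MDiff f) (hg : MDiff g) (z w : ℍ) :
    lineIntegral (f + g) z w = lineIntegral f z w + lineIntegral g z w := by
  rw [lineIntegral, lineIntegral, lineIntegral, ← intervalIntegral.integral_add
    (intervalIntegrable_segment hf z w) (intervalIntegrable_segment hg z w)]
  simp only [Pi.add_apply, add_mul]

theorem lineIntegral_smul (c : ℂ) (f : ℍ → ℂ) (z w : ℍ) :
    lineIntegral (c • f) z w = c * lineIntegral f z w := by
  rw [lineIntegral, lineIntegral, ← intervalIntegral.integral_const_mul]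
  simp only [Pi.smul_apply, smul_eq_mul, mul_assoc]

/-- The bilinear form `(f⁰, f¹) ↦ ∫_{z₀}^{γ₀ z₀} f⁰ · (f¹ | γ₁) dz` on forms of weights
`k₀`, `k₁`. -/
def integralPairing (z₀ : ℍ) (k₀ k₁ : ℤ) (γ₀ γ₁ : GL(2, ℚ)⁺) :
    formsOfWeight k₀ →ₗ[ℂ] formsOfWeight k₁ →ₗ[ℂ] ℂ :=
  LinearMap.mk₂ ℂ
    (fun f₀ f₁ ↦ lineIntegral ((f₀ : ℍ → ℂ) * slash k₁ γ₁ f₁) z₀ (toGLReal γ₀ • z₀))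
    (fun f f' g ↦ by
      rw [Submodule.coe_add, add_mul]
      exact lineIntegral_add (f.2.mdiff.mul (g.2.slash γ₁).mdiff)
        (f'.2.mdiff.mul (g.2.slash γ₁).mdiff) _ _)
    (fun c f g ↦ by
      rw [Submodule.coe_smul, smul_mul_assoc, lineIntegral_smul]
      rfl)
    (fun f g g' ↦ by
      rw [Submodule.coe_add, slash_add, mul_add]
      exact lineIntegral_add (f.2.mdiff.mul (g.2.slash γ₁).mdiff)
        (f.2.mdiff.mul (g'.2.slash γ₁).mdiff) _ _)
    (fun c f g ↦ by
      rw [Submodule.coe_smul, slash_smul, mul_smul_comm, lineIntegral_smul]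
      rfl)

open Classical in
/-- The value of `τ₀` on `(f⁰ U_{γ₀}, f¹ U_{γ₁})` with `f⁰`, `f¹` homogeneous: it vanishes unless
`γ₀ γ₁ = 1` and the weights add up to `2`. -/
def tau0Homogeneous (z₀ : ℍ) (k₀ k₁ : ℤ) (γ₀ γ₁ : GL(2, ℚ)⁺) :
    formsOfWeight k₀ →ₗ[ℂ] formsOfWeight k₁ →ₗ[ℂ] ℂ :=
  if k₀ + k₁ = 2 ∧ γ₀ * γ₁ = 1 then integralPairing z₀ k₀ k₁ γ₀ γ₁ else 0

/-- The cochain `τ₀` on `𝒜`, extended bilinearly from homogeneous monomials. -/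
def tau0 (z₀ : ℍ) : CrossedProduct →ₗ[ℂ] CrossedProduct →ₗ[ℂ] ℂ :=
  liftCross fun γ₀ ↦ liftForm fun k₀ ↦
    (liftCross fun γ₁ ↦ liftForm fun k₁ ↦ (tau0Homogeneous z₀ k₀ k₁ γ₀ γ₁).flip).flip

theorem tau0_mono_eq (z₀ : ℍ) (k₀ k₁ : ℤ) (γ₀ γ₁ : GL(2, ℚ)⁺) (f₀ : formsOfWeight k₀)
    (f₁ : formsOfWeight k₁) : tau0 z₀ (mono (form k₀ f₀) γ₀) (mono (form k₁ f₁) γ₁) =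
      tau0Homogeneous z₀ k₀ k₁ γ₀ γ₁ f₀ f₁ := by
  rw [tau0, liftCross_mono, liftForm_form, LinearMap.flip_apply, liftCross_mono, liftForm_form,
    LinearMap.flip_apply]

theorem tau0_mono (z₀ : ℍ) {k₀ k₁ : ℤ} {γ₀ γ₁ : GL(2, ℚ)⁺} (hk : k₀ + k₁ = 2)
    (hγ : γ₀ * γ₁ = 1) (f₀ : formsOfWeight k₀) (f₁ : formsOfWeight k₁) :
    tau0 z₀ (mono (form k₀ f₀) γ₀) (mono (form k₁ f₁) γ₁) =
      lineIntegral ((f₀ : ℍ → ℂ) * slash k₁ γ₁ f₁) z₀ (toGLReal γ₀ • z₀) := by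
  rw [tau0_mono_eq, tau0Homogeneous, if_pos ⟨hk, hγ⟩]
  rfl

theorem tau0_mono_of_not (z₀ : ℍ) {k₀ k₁ : ℤ} {γ₀ γ₁ : GL(2, ℚ)⁺}
    (h : ¬(k₀ + k₁ = 2 ∧ γ₀ * γ₁ = 1)) (f₀ : formsOfWeight k₀) (f₁ : formsOfWeight k₁) :
    tau0 z₀ (mono (form k₀ f₀) γ₀) (mono (form k₁ f₁) γ₁) = 0 := by
  rw [tau0_mono_eq, tau0Homogeneous, if_neg h]
  rfl

/-! ### Cyclic cocycles and invariance -/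

/-- A bilinear form `τ` is a cyclic `1`-cocycle on `𝒜`: it is cyclic,
`τ(a⁰, a¹) = - τ(a¹, a⁰)`, and its Hochschild coboundary
`b τ (a⁰, a¹, a²) = τ(a⁰a¹, a²) - τ(a⁰, a¹a²) + τ(a²a⁰, a¹)` vanishes. -/
def IsCyclicOneCocycle (τ : CrossedProduct →ₗ[ℂ] CrossedProduct →ₗ[ℂ] ℂ) : Prop :=
  (∀ a₀ a₁, τ a₀ a₁ = -τ a₁ a₀) ∧
    ∀ a₀ a₁ a₂, τ (a₀ * a₁) a₂ - τ a₀ (a₁ * a₂) + τ (a₂ * a₀) a₁ = 0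

/-- For `t = ∑ x ⊗ y` in `ℋ₁ ⊗ ℋ₁`, the value `∑ τ(x a⁰, y a¹)`. -/
def evalTensor (ρ : H1 →ₐ[ℂ] Module.End ℂ CrossedProduct)
    (τ : CrossedProduct →ₗ[ℂ] CrossedProduct →ₗ[ℂ] ℂ) (a₀ a₁ : CrossedProduct) :
    H1 ⊗[ℂ] H1 →ₗ[ℂ] ℂ :=
  TensorProduct.lift (τ.compl₁₂ (ρ.toLinearMap.flip a₀) (ρ.toLinearMap.flip a₁))

theorem evalTensor_tmul (ρ : H1 →ₐ[ℂ] Module.End ℂ CrossedProduct)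
    (τ : CrossedProduct →ₗ[ℂ] CrossedProduct →ₗ[ℂ] ℂ) (a₀ a₁ : CrossedProduct) (x y : H1) :
    evalTensor ρ τ a₀ a₁ (x ⊗ₜ y) = τ (ρ x a₀) (ρ y a₁) := rfl

/-- Invariance of `τ` with respect to the modular character `δ`:
`∑ τ(h₍₁₎ a⁰, h₍₂₎ a¹) = δ(h) τ(a⁰, a¹)` for all `h` in `ℋ₁`. -/
def IsDeltaInvariant (ρ : H1 →ₐ[ℂ] Module.End ℂ CrossedProduct)
    (τ : CrossedProduct →ₗ[ℂ] CrossedProduct →ₗ[ℂ] ℂ) : Prop :=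
  ∀ (h : H1) (a₀ a₁ : CrossedProduct),
    evalTensor ρ τ a₀ a₁ (Coalgebra.comul (R := ℂ) h) = H1.modularCharacter h * τ a₀ a₁

end ModularSymbol

end

/-!
Write `φ_α(f) = ∫_{z₀}^{α z₀} f₂ dz` for the period of the weight `2` component of `f ∈ ℳ`. Cutting
the path from `z₀` to `αβ z₀` at `α z₀` and changing variables on the second half gives
`φ_{αβ}(f) = φ_α(f) + φ_β(f | α)`, so `φ` is a `1`-cocycle of `GL⁺(2, ℚ)` with values in the dual
of `ℳ`, and `τ₀(f U_α, g U_α⁻¹) = φ_α(f · (g | α⁻¹))`. For any group acting on a commutative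
algebra, a `1`-cocycle with values in the dual defines a cyclic `1`-cocycle on the crossed product
by this formula.

Invariance has to be checked on `X`, `Y`, `δ₁` only. By the Leibniz rules the sum belonging to a
generator is `φ_α` applied to the image of `f · (g | α⁻¹)` under the Ramanujan derivation for `X`,
the Euler derivation for `Y`, and `0` for `δ₁`. The Euler derivation is the identity in weight `2`,
and the Ramanujan derivation reaches weight `2` only from weight `0`, where it is zero because
modular forms of weight `0` are constant.
-/

namespace ModularSymbol

section DualCocycle

open SkewMonoidAlgebra (single single_mul_single)

theorem bilinear_ext_single {k M G N : Type*} [CommSemiring k] [AddCommMonoid M] [Module k M]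
    [AddCommMonoid N] [Module k N] {σ τ : SkewMonoidAlgebra M G →ₗ[k] SkewMonoidAlgebra M G →ₗ[k] N}
    (h : ∀ α f β g, σ (single α f) (single β g) = τ (single α f) (single β g)) : σ = τ :=
  SkewMonoidAlgebra.lhom_ext fun α f ↦ SkewMonoidAlgebra.lhom_ext fun β g ↦ h α f β g

variable {k M G N : Type*} [CommSemiring k] [CommSemiring M] [Module k M] [Group G]
  [MulSemiringAction G M] [AddCommGroup N] [Module k N]

/-- A `1`-cocycle of `G` with values in the `k`-linear maps `M → N`, on which `α : G` acts by
precomposition with `α⁻¹`. -/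
def IsDualCocycle (φ : G → M →ₗ[k] N) : Prop :=
  ∀ α β x, φ (α * β) x = φ α x + φ β (α⁻¹ • x)

/-- The bilinear form `τ` on the crossed product is `φ_α(f · (α • g))` on `(f U_α, g U_α⁻¹)` and
vanishes on `(f U_α, g U_β)` for `β ≠ α⁻¹`. -/
structure IsInducedBy (τ : SkewMonoidAlgebra M G →ₗ[k] SkewMonoidAlgebra M G →ₗ[k] N)
    (φ : G → M →ₗ[k] N) : Prop where
  single_inv (α : G) (f g : M) : τ (single α f) (single α⁻¹ g) = φ α (f * α • g)
  single_of_ne {α β : G} (h : β ≠ α⁻¹) (f g : M) :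
    τ (single α f) (single β g) = 0

theorem IsDualCocycle.map_one {φ : G → M →ₗ[k] N} (hφ : IsDualCocycle φ) (x : M) : φ 1 x = 0 := by
  simpa using hφ 1 1 x

theorem IsDualCocycle.map_inv {φ : G → M →ₗ[k] N} (hφ : IsDualCocycle φ) (α : G) (x : M) :
    φ α⁻¹ (α⁻¹ • x) = -φ α x := by
  rw [eq_neg_iff_add_eq_zero, add_comm, ← hφ, mul_inv_cancel, hφ.map_one]

variable {τ : SkewMonoidAlgebra M G →ₗ[k] SkewMonoidAlgebra M G →ₗ[k] N} {φ : G → M →ₗ[k] N}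

theorem IsInducedBy.apply_eq_neg (hτ : IsInducedBy τ φ) (hφ : IsDualCocycle φ)
    (a b : SkewMonoidAlgebra M G) : τ a b = -τ b a := by
  suffices h : τ = -τ.flip from LinearMap.congr_fun₂ h a b
  refine bilinear_ext_single fun α f β g ↦ ?_
  rw [LinearMap.neg_apply, LinearMap.neg_apply, LinearMap.flip_apply]
  obtain rfl | hβ := eq_or_ne β α⁻¹
  · have hswap : τ (single α⁻¹ g) (single α f) = φ α⁻¹ (g * α⁻¹ • f) := by
      simpa only [inv_inv] using hτ.single_inv α⁻¹ g f
    have hmove : g * α⁻¹ • f = α⁻¹ • (f * α • g) := by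
      rw [smul_mul', inv_smul_smul, mul_comm]
    rw [hτ.single_inv, hswap, hmove, hφ.map_inv, neg_neg]
  · have hα : α ≠ β⁻¹ := fun h ↦ hβ (by rw [h, inv_inv])
    rw [hτ.single_of_ne hβ, hτ.single_of_ne hα, neg_zero]

theorem IsInducedBy.hochschild_single (hτ : IsInducedBy τ φ) (hφ : IsDualCocycle φ)
    (α β γ : G) (f g h : M) :
    τ (single α f * single β g) (single γ h) - τ (single α f) (single β g * single γ h) +
      τ (single γ h * single α f) (single β g) = 0 := by
  -- After rotating the last term, the identity is the cocycle relation for `φ_{αβ}` at one element.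
  rw [hτ.apply_eq_neg hφ (single γ h * single α f)]
  simp only [single_mul_single]
  obtain rfl | hγ := eq_or_ne γ (α * β)⁻¹
  · set x : M := f * α • g * (α * β) • h with hx
    have eval_mul_left : τ (single (α * β) (f * α • g)) (single (α * β)⁻¹ h) = φ (α * β) x :=
      hτ.single_inv ..
    have eval_mul_right : τ (single α f) (single (β * (α * β)⁻¹) (g * β • h)) = φ α x := by
      rw [show β * (α * β)⁻¹ = α⁻¹ by group, hτ.single_inv, smul_mul', smul_smul, ← mul_assoc]
    have hmove : g * β • (h * (α * β)⁻¹ • f) = α⁻¹ • x := by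
      simp only [hx, smul_mul', smul_smul, mul_inv_rev, mul_inv_cancel_left, inv_mul_cancel,
        inv_mul_cancel_left, one_smul]
      ring
    have eval_rotated :
        τ (single β g) (single ((α * β)⁻¹ * α) (h * (α * β)⁻¹ • f)) = φ β (α⁻¹ • x) := by
      rw [show (α * β)⁻¹ * α = β⁻¹ by group, hτ.single_inv, hmove]
    rw [eval_mul_left, eval_mul_right, eval_rotated, hφ]
    abel
  · have hβγ : β * γ ≠ α⁻¹ := fun e ↦ hγ (by rw [mul_inv_rev, ← e, inv_mul_cancel_left])
    have hγα : γ * α ≠ β⁻¹ := fun e ↦ hγ (by rw [mul_inv_rev, ← e, mul_inv_cancel_right])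
    rw [hτ.single_of_ne hγ, hτ.single_of_ne hβγ, hτ.single_of_ne hγα, sub_zero, neg_zero, add_zero]

theorem IsInducedBy.hochschild (hτ : IsInducedBy τ φ) (hφ : IsDualCocycle φ)
    (a b c : SkewMonoidAlgebra M G) : τ (a * b) c - τ a (b * c) + τ (c * a) b = 0 := by
  induction a using SkewMonoidAlgebra.induction_on with
  | zero => simp
  | add a a' h h' =>
    simp only [add_mul, mul_add, map_add, LinearMap.add_apply]
    linear_combination (norm := abel) h + h'
  | single α f =>
    induction b using SkewMonoidAlgebra.induction_on with
    | zero => simp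
    | add b b' h h' =>
      simp only [add_mul, mul_add, map_add, LinearMap.add_apply]
      linear_combination (norm := abel) h + h'
    | single β g =>
      induction c using SkewMonoidAlgebra.induction_on with
      | zero => simp
      | add c c' h h' =>
        simp only [add_mul, mul_add, map_add, LinearMap.add_apply]
        linear_combination (norm := abel) h + h'
      | single γ h => exact hτ.hochschild_single hφ α β γ f g h

end DualCocycle

section HopfInvariance

variable {ρ : H1 →ₐ[ℂ] Module.End ℂ CrossedProduct}
  {τ : CrossedProduct →ₗ[ℂ] CrossedProduct →ₗ[ℂ] ℂ}

theorem evalTensor_mul_tmul (a₀ a₁ : CrossedProduct) (t : H1 ⊗[ℂ] H1) (x y : H1) :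
    evalTensor ρ τ a₀ a₁ (t * (x ⊗ₜ y)) = evalTensor ρ τ (ρ x a₀) (ρ y a₁) t := by
  induction t using TensorProduct.induction_on with
  | zero => simp
  | add s t hs ht => rw [add_mul, map_add, map_add, hs, ht]
  | tmul u v =>
    simp only [Algebra.TensorProduct.tmul_mul_tmul, evalTensor_tmul, map_mul, Module.End.mul_apply]

theorem evalTensor_comulHom_mul {a : H1} {c : ℂ}
    (ha : ∀ a₀ a₁, evalTensor ρ τ a₀ a₁ (H1.comulHom a) = c * τ a₀ a₁) (a₀ a₁ : CrossedProduct)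
    (t : H1 ⊗[ℂ] H1) :
    evalTensor ρ τ a₀ a₁ (H1.comulHom a * t) = c * evalTensor ρ τ a₀ a₁ t := by
  induction t using TensorProduct.induction_on with
  | zero => simp
  | add s t hs ht => rw [mul_add, map_add, hs, ht, map_add, mul_add]
  | tmul x y => rw [evalTensor_mul_tmul, ha, evalTensor_tmul]

/-- The elements `h` of `ℋ₁` with `∑ τ(h₍₁₎ a⁰, h₍₂₎ a¹) = δ(h) τ(a⁰, a¹)` for all `a⁰`, `a¹`;
being a subalgebra, they are all of `ℋ₁` as soon as they contain `X`, `Y` and `δ₁`. -/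
def invariantSubalgebra (ρ : H1 →ₐ[ℂ] Module.End ℂ CrossedProduct)
    (τ : CrossedProduct →ₗ[ℂ] CrossedProduct →ₗ[ℂ] ℂ) : Subalgebra ℂ H1 where
  carrier := {h | ∀ a₀ a₁, evalTensor ρ τ a₀ a₁ (H1.comulHom h) =
    H1.modularCharacter h * τ a₀ a₁}
  algebraMap_mem' r a₀ a₁ := by
    simp [Algebra.algebraMap_eq_smul_one, Algebra.TensorProduct.one_def, evalTensor_tmul]
  add_mem' ha hb a₀ a₁ := by rw [map_add, map_add, map_add, ha, hb, add_mul]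
  mul_mem' ha hb a₀ a₁ := by
    rw [map_mul, evalTensor_comulHom_mul ha, hb, map_mul, mul_assoc]

theorem isDeltaInvariant_of_generators
    (hX : ∀ a₀ a₁, τ (ρ H1.X a₀) a₁ + τ a₀ (ρ H1.X a₁) +
      τ (ρ (H1.delta 0) a₀) (ρ H1.Y a₁) = 0)
    (hY : ∀ a₀ a₁, τ (ρ H1.Y a₀) a₁ + τ a₀ (ρ H1.Y a₁) = τ a₀ a₁)
    (hδ : ∀ a₀ a₁, τ (ρ (H1.delta 0) a₀) a₁ + τ a₀ (ρ (H1.delta 0) a₁) = 0) :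
    IsDeltaInvariant ρ τ := by
  refine H1.mem_of_generators (invariantSubalgebra ρ τ) (fun a₀ a₁ ↦ ?_) (fun a₀ a₁ ↦ ?_)
    fun a₀ a₁ ↦ ?_
  · rw [H1.comulHom_X, H1.modularCharacter, H1.lift_X]
    simpa [evalTensor_tmul] using hX a₀ a₁
  · rw [H1.comulHom_Y, H1.modularCharacter, H1.lift_Y]
    simpa [evalTensor_tmul] using hY a₀ a₁
  · rw [H1.comulHom_delta, H1.modularCharacter, H1.lift_delta]
    simpa [evalTensor_tmul, H1.iter] using hδ a₀ a₁

end HopfInvariance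

section StandardAction

variable {τ : CrossedProduct →ₗ[ℂ] CrossedProduct →ₗ[ℂ] ℂ} {φ : GL(2, ℚ)⁺ → FormAlgebra →ₗ[ℂ] ℂ}

theorem muForm_one : muForm 1 = 0 := by
  simpa [slashLin_one] using muForm_mul 1 1

theorem muForm_inv_add_smul (α : GL(2, ℚ)⁺) : muForm α⁻¹ + α • muForm α = 0 := by
  rw [smul_def, add_comm, ← muForm_mul, mul_inv_cancel, muForm_one]

theorem opX_smul (α : GL(2, ℚ)⁺) (g : FormAlgebra) :
    opX (α • g) = α • opX g + muForm α⁻¹ * α • opY g :=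
  opX_slashLin α⁻¹ g

theorem opY_smul (α : GL(2, ℚ)⁺) (g : FormAlgebra) : opY (α • g) = α • opY g :=
  opY_slashLin α⁻¹ g

theorem standardAction_delta_zero (f : FormAlgebra) (γ : GL(2, ℚ)⁺) :
    standardAction (H1.delta 0) (mono f γ) = mono (muForm γ⁻¹ * f) γ :=
  standardAction_delta 0 f γ

theorem IsInducedBy.invariant_X (hτ : IsInducedBy τ φ) (hφ : ∀ α x, φ α (opX x) = 0)
    (a₀ a₁ : CrossedProduct) :
    τ (standardAction H1.X a₀) a₁ + τ a₀ (standardAction H1.X a₁) +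
      τ (standardAction (H1.delta 0) a₀) (standardAction H1.Y a₁) = 0 := by
  suffices h : τ.compl₁₂ (standardAction H1.X) .id + τ.compl₁₂ .id (standardAction H1.X) +
      τ.compl₁₂ (standardAction (H1.delta 0)) (standardAction H1.Y) = 0 from
    LinearMap.congr_fun₂ h a₀ a₁
  refine bilinear_ext_single fun α f β g ↦ ?_
  simp only [LinearMap.add_apply, LinearMap.compl₁₂_apply, LinearMap.id_apply,
    LinearMap.zero_apply, standardAction_X, standardAction_Y, standardAction_delta_zero]
  obtain rfl | hβ := eq_or_ne β α⁻¹
  · have leibniz : opX f * α • g + f * α • opX g + muForm α⁻¹ * f * α • opY g =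
        opX (f * α • g) := by
      rw [opX_mul, opX_smul]
      ring
    rw [hτ.single_inv, hτ.single_inv, hτ.single_inv, ← map_add, ← map_add, leibniz, hφ]
  · simp only [hτ.single_of_ne hβ, add_zero]

theorem IsInducedBy.invariant_Y (hτ : IsInducedBy τ φ) (hφ : ∀ α x, φ α (opY x) = φ α x)
    (a₀ a₁ : CrossedProduct) :
    τ (standardAction H1.Y a₀) a₁ + τ a₀ (standardAction H1.Y a₁) = τ a₀ a₁ := by
  suffices h : τ.compl₁₂ (standardAction H1.Y) .id + τ.compl₁₂ .id (standardAction H1.Y) = τ from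
    LinearMap.congr_fun₂ h a₀ a₁
  refine bilinear_ext_single fun α f β g ↦ ?_
  simp only [LinearMap.add_apply, LinearMap.compl₁₂_apply, LinearMap.id_apply, standardAction_Y]
  obtain rfl | hβ := eq_or_ne β α⁻¹
  · have leibniz : opY f * α • g + f * α • opY g = opY (f * α • g) := by
      rw [opY_mul, opY_smul]
    rw [hτ.single_inv, hτ.single_inv, hτ.single_inv, ← map_add, leibniz, hφ]
  · simp only [hτ.single_of_ne hβ, add_zero]

theorem IsInducedBy.invariant_delta (hτ : IsInducedBy τ φ) (a₀ a₁ : CrossedProduct) :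
    τ (standardAction (H1.delta 0) a₀) a₁ + τ a₀ (standardAction (H1.delta 0) a₁) = 0 := by
  suffices h : τ.compl₁₂ (standardAction (H1.delta 0)) .id +
      τ.compl₁₂ .id (standardAction (H1.delta 0)) = 0 from LinearMap.congr_fun₂ h a₀ a₁
  refine bilinear_ext_single fun α f β g ↦ ?_
  simp only [LinearMap.add_apply, LinearMap.compl₁₂_apply, LinearMap.id_apply,
    LinearMap.zero_apply, standardAction_delta_zero]
  obtain rfl | hβ := eq_or_ne β α⁻¹
  · have cancel : muForm α⁻¹ * f * α • g + f * α • (muForm (α⁻¹)⁻¹ * g) = 0 := by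
      rw [inv_inv, smul_mul']
      linear_combination f * α • g * muForm_inv_add_smul α
    rw [hτ.single_inv, hτ.single_inv, ← map_add, cancel, map_zero]
  · simp only [hτ.single_of_ne hβ, add_zero]

theorem IsInducedBy.isDeltaInvariant (hτ : IsInducedBy τ φ) (hX : ∀ α x, φ α (opX x) = 0)
    (hY : ∀ α x, φ α (opY x) = φ α x) : IsDeltaInvariant standardAction τ :=
  isDeltaInvariant_of_generators (hτ.invariant_X hX) (hτ.invariant_Y hY) hτ.invariant_delta

end StandardAction

section LineIntegral

variable {f : ℍ → ℂ}

theorem exists_primitive (hf : MDiff f) : ∃ F : ℂ → ℂ, ∀ z : ℍ, HasDerivAt F (f z) z := by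
  obtain ⟨F, hF⟩ := (convex_halfSpace_im_gt 0).exists_forall_hasDerivWithinAt
    (UpperHalfPlane.mdifferentiable_iff.mp hf)
  refine ⟨F, fun z ↦ ?_⟩
  simpa using (hF z z.2).hasDerivAt (isOpen_upperHalfPlaneSet.mem_nhds z.2)

theorem lineIntegral_eq_sub (hf : MDiff f) {F : ℂ → ℂ} (hF : ∀ z : ℍ, HasDerivAt F (f z) z)
    (z w : ℍ) : lineIntegral f z w = F w - F z := by
  have hderiv : ∀ t ∈ Set.uIcc (0 : ℝ) 1, HasDerivAt (fun t : ℝ ↦ F (z + t * (w - z)))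
      (f (ofComplex (z + t * (w - z))) * ((w : ℂ) - z)) t := by
    intro t ht
    have him := segment_im_pos z w (Set.uIcc_of_le (zero_le_one (α := ℝ)) ▸ ht)
    have houter : HasDerivAt F (f (ofComplex (z + t * (w - z)))) ((z : ℂ) + t * (w - z)) := by
      rw [ofComplex_apply_of_im_pos him]
      exact hF ⟨_, him⟩
    have hinner : HasDerivAt (fun t : ℝ ↦ (z : ℂ) + t * (w - z)) ((w : ℂ) - z) t := by
      simpa using ((ofRealCLM.hasDerivAt (x := t)).mul_const ((w : ℂ) - z)).const_add (z : ℂ)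
    exact houter.comp t hinner
  rw [lineIntegral, intervalIntegral.integral_eq_sub_of_hasDerivAt hderiv
    (intervalIntegrable_segment hf z w)]
  simp

theorem lineIntegral_add_adjacent (hf : MDiff f) (z w v : ℍ) :
    lineIntegral f z w + lineIntegral f w v = lineIntegral f z v := by
  obtain ⟨F, hF⟩ := exists_primitive hf
  simp only [lineIntegral_eq_sub hf hF]
  ring

theorem mdiff_slash (hf : MDiff f) (k : ℤ) (γ : GL(2, ℚ)⁺) : MDiff (slash k γ f) := by
  rw [slash_eq]
  exact (hf.slash k _).const_smul _

theorem slash_two_apply (γ : GL(2, ℚ)⁺) (f : ℍ → ℂ) (z : ℍ) :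
    slash 2 γ f z =
      f (toGLReal γ • z) * ((toGLReal γ).val.det / denom (toGLReal γ) z ^ 2) := by
  have hsq : ((√((toGLReal γ).det.val) : ℝ) : ℂ) ^ (2 : ℤ) = ((toGLReal γ).val.det : ℂ) := by
    rw [zpow_ofNat, ← ofReal_pow, Real.sq_sqrt (toGLReal_det_pos γ).le,
      Matrix.GeneralLinearGroup.val_det_apply]
  rw [slash, hsq, zpow_neg, zpow_ofNat]
  ring

theorem hasDerivAt_comp_smul {F : ℂ → ℂ} (hF : ∀ z : ℍ, HasDerivAt F (f z) z) (γ : GL(2, ℚ)⁺)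
    (z : ℍ) :
    HasDerivAt (fun u : ℂ ↦ F (toGLReal γ • ofComplex u : ℍ)) (slash 2 γ f z) z := by
  have houter : HasDerivAt F (f (toGLReal γ • z)) (toGLReal γ • ofComplex (z : ℂ) : ℍ) := by
    rw [ofComplex_apply]
    exact hF _
  rw [slash_two_apply]
  exact houter.comp (z : ℂ)
    (UpperHalfPlane.hasStrictDerivAt_smul (toGLReal_val_det_pos γ) z).hasDerivAt

theorem lineIntegral_slash (hf : MDiff f) (γ : GL(2, ℚ)⁺) (z w : ℍ) :
    lineIntegral (slash 2 γ f) z w = lineIntegral f (toGLReal γ • z) (toGLReal γ • w) := by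
  obtain ⟨F, hF⟩ := exists_primitive hf
  rw [lineIntegral_eq_sub (mdiff_slash hf 2 γ) (hasDerivAt_comp_smul hF γ),
    lineIntegral_eq_sub hf hF, ofComplex_apply, ofComplex_apply]

end LineIntegral

section Period

theorem IsModular.exists_eq_const {f : ℍ → ℂ} (hf : IsModular 0 f) : ∃ c : ℂ, f = fun _ ↦ c := by
  obtain ⟨N, hN, F, rfl⟩ := hf
  have : NeZero N := ⟨hN⟩
  exact F.eq_const_of_weight_zero

theorem ramanujan_weight_zero {f : ℍ → ℂ} (hf : IsModular 0 f) : ramanujan 0 f = 0 := by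
  obtain ⟨c, rfl⟩ := hf.exists_eq_const
  ext z
  simp [ramanujan_eq, Derivative.serreDerivative_apply]

/-- The functional `f ↦ ∫_z^w f₂(ζ) dζ` on `ℳ`, where `f₂` is the component of weight `2`. -/
noncomputable def period (z w : ℍ) : FormAlgebra →ₗ[ℂ] ℂ where
  toFun x := lineIntegral (component 2 x : ℍ → ℂ) z w
  map_add' x y := by
    rw [map_add, Submodule.coe_add]
    exact lineIntegral_add (component 2 x).2.mdiff (component 2 y).2.mdiff z w
  map_smul' c x := by
    rw [map_smul, Submodule.coe_smul, lineIntegral_smul, RingHom.id_apply, smul_eq_mul]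

theorem period_apply (z w : ℍ) (x : FormAlgebra) :
    period z w x = lineIntegral (component 2 x : ℍ → ℂ) z w := rfl

theorem period_form {k : ℤ} (hk : k = 2) (z w : ℍ) (f : formsOfWeight k) :
    period z w (form k f) = lineIntegral (f : ℍ → ℂ) z w := by
  subst hk
  rw [period_apply]
  congr 2

theorem period_form_of_ne {k : ℤ} (hk : k ≠ 2) (z w : ℍ) (f : formsOfWeight k) :
    period z w (form k f) = 0 := by
  have hcomponent : component 2 (form k f) = 0 :=
    DirectSum.of_eq_of_ne (β := fun k ↦ formsOfWeight k) k 2 f hk.symm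
  simp [period_apply, hcomponent, lineIntegral]

theorem period_add_adjacent (z w v : ℍ) (x : FormAlgebra) :
    period z w x + period w v x = period z v x :=
  lineIntegral_add_adjacent (component 2 x).2.mdiff z w v

theorem period_slashLin (γ : GL(2, ℚ)⁺) (z w : ℍ) (x : FormAlgebra) :
    period z w (slashLin γ x) = period (toGLReal γ • z) (toGLReal γ • w) x := by
  induction x using form_induction with
  | h0 => simp
  | ha x y hx hy => simp only [map_add, hx, hy]
  | hf k f =>
    rw [slashLin_form]
    obtain rfl | hk := eq_or_ne k 2
    · rw [period_form rfl, period_form rfl]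
      exact lineIntegral_slash f.2.mdiff γ z w
    · rw [period_form_of_ne hk, period_form_of_ne hk]

theorem period_opX (z w : ℍ) (x : FormAlgebra) : period z w (opX x) = 0 := by
  induction x using form_induction with
  | h0 => simp
  | ha x y hx hy => simp only [map_add, hx, hy, add_zero]
  | hf k f =>
    rw [opX_form]
    obtain rfl | hk := eq_or_ne k 0
    · have hconst : ramanujanForm 0 f = 0 := Subtype.ext (ramanujan_weight_zero f.2)
      rw [hconst, map_zero, map_zero]
    · exact period_form_of_ne (by lia) z w _

theorem period_opY (z w : ℍ) (x : FormAlgebra) : period z w (opY x) = period z w x := by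
  induction x using form_induction with
  | h0 => simp
  | ha x y hx hy => simp only [map_add, hx, hy]
  | hf k f =>
    rw [opY_form, map_smul]
    obtain rfl | hk := eq_or_ne k 2
    · simp
    · rw [period_form_of_ne hk, smul_zero]

/-- The functionals `φ_γ(f) = ∫_{z₀}^{γ z₀} f₂(ζ) dζ`, the `1`-cocycle inducing `τ₀`. -/
noncomputable def periodCocycle (z₀ : ℍ) (γ : GL(2, ℚ)⁺) : FormAlgebra →ₗ[ℂ] ℂ :=
  period z₀ (toGLReal γ • z₀)

theorem isDualCocycle_periodCocycle (z₀ : ℍ) : IsDualCocycle (periodCocycle z₀) := by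
  intro α β x
  have hmove : periodCocycle z₀ β (α⁻¹ • x) =
      period (toGLReal α • z₀) (toGLReal (α * β) • z₀) x := by
    rw [periodCocycle, smul_def, inv_inv, period_slashLin, smul_smul, ← map_mul]
  rw [hmove, periodCocycle, periodCocycle, period_add_adjacent]

theorem tau0_mono_inv (z₀ : ℍ) (α : GL(2, ℚ)⁺) (f g : FormAlgebra) :
    tau0 z₀ (mono f α) (mono g α⁻¹) = periodCocycle z₀ α (f * α • g) := by
  rw [periodCocycle, smul_def]
  induction f using form_induction with
  | h0 => simp
  | ha f f' hf hf' => rw [mono_add, map_add, LinearMap.add_apply, hf, hf', add_mul, map_add]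
  | hf k f =>
    induction g using form_induction with
    | h0 => simp
    | ha g g' hg hg' => rw [mono_add, map_add, hg, hg', map_add, mul_add, map_add]
    | hf l g =>
      rw [slashLin_form, form_mul_form]
      obtain hkl | hkl := eq_or_ne (k + l) 2
      · rw [tau0_mono z₀ hkl (mul_inv_cancel α), period_form hkl]
        rfl
      · rw [tau0_mono_of_not z₀ fun h ↦ hkl h.1, period_form_of_ne hkl]

theorem tau0_mono_of_ne_inv (z₀ : ℍ) {α β : GL(2, ℚ)⁺} (h : β ≠ α⁻¹) (f g : FormAlgebra) :
    tau0 z₀ (mono f α) (mono g β) = 0 := by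
  induction f using form_induction with
  | h0 => simp
  | ha f f' hf hf' => rw [mono_add, map_add, LinearMap.add_apply, hf, hf', add_zero]
  | hf k f =>
    induction g using form_induction with
    | h0 => simp
    | ha g g' hg hg' => rw [mono_add, map_add, hg, hg', add_zero]
    | hf l g => exact tau0_mono_of_not z₀ (fun hαβ ↦ h (eq_inv_of_mul_eq_one_right hαβ.2)) f g

theorem isInducedBy_tau0 (z₀ : ℍ) : IsInducedBy (tau0 z₀) (periodCocycle z₀) :=
  ⟨tau0_mono_inv z₀, tau0_mono_of_ne_inv z₀⟩

end Period

end ModularSymbol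

theorem mainTheorem5 (z₀ : UpperHalfPlane) :
    ModularSymbol.IsCyclicOneCocycle (ModularSymbol.tau0 z₀) ∧
      ModularSymbol.IsDeltaInvariant ModularSymbol.standardAction (ModularSymbol.tau0 z₀) := by
  have hτ := ModularSymbol.isInducedBy_tau0 z₀
  have hφ := ModularSymbol.isDualCocycle_periodCocycle z₀
  exact ⟨⟨hτ.apply_eq_neg hφ, hτ.hochschild hφ⟩,
    hτ.isDeltaInvariant (fun _ ↦ ModularSymbol.period_opX z₀ _)
      fun _ ↦ ModularSymbol.period_opY z₀ _⟩
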